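/- Let $n,m,p,d,\delta\ge 0$ be integers, let $q\in(-\infty,1)$, and let $g_1,\dots,g_m\in\mathbb R[x]=\mathbb R[x_1,\dots,x_n]$, where one of the $g_j$ equals $R^2-\sum_{i=1}^n x_i^2$ for some $R\in\mathbb R$. Suppose that $\mathcal X=\{x\in\mathbb R^n: g_j(x)\ge 0,\ j=1,\dots,m\}$ (a compact set) has nonempty interior. Let $\mathbf v_d(x)=(x^\alpha)_{|\alpha|\le d}$, let $\mathfrak A$ be a real $p\times\binom{n+d}{n}$ matrix of rank $p$, and let $\mathbf F=\mathfrak A\mathbf v_d$. *Notation.* For a polynomial $f=\sum f_\alpha x^\alpha$ and a sequence $\mathbf y=(y_\alpha)_{|\alpha|\le k}$ with $k\ge\deg f$, put $L_{\mathbf y}(f)=\sum f_\alpha y_\alpha$. Let $M_e(\mathbf y)=(y_{\alpha+\beta})_{|\alpha|,|\beta|\le e}$ and $M_e(f\mathbf y)=(L_{\mathbf y}(f x^{\alpha+\beta}))_{|\alpha|,|\beta|\le e}$ (for $\mathbf y$ of sufficiently high order), $v_j=\lceil\deg(g_j)/2\rceil$, and $\mathbf M_d(\mathbf y)=\mathfrak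 A M_d(\mathbf y)\mathfrak A^{\top}$. - $\mathcal M^{\mathsf{SDP}}_{2(d+\delta)}(\mathcal X)$ is the set of all $\mathbf y\in\mathbb R^{\binom{n+2d}{n}}$ that extend to some $\mathbf z=(z_\alpha)_{|\alpha|\le 2(d+\delta)}$ with $M_{d+\delta}(\mathbf z)\succcurlyeq 0$ and $M_{d+\delta-v_j}(g_j\mathbf z)\succcurlyeq 0$ for all $j$ with $v_j\le d+\delta$. - $\Sigma[x]_{2e}$ is the set of sums of squares of polynomials of degree at most $e$, and $\mathcal P^{\mathsf{SOS}}_{2(d+\delta)}(\mathcal X)$ is the set of polynomials $h=\sigma_0+\sum_{j=1}^m g_j\sigma_j$ of degree at most $2d$ with $\sigma_0\in\Sigma[x]_{2(d+\delta)}$ and $\sigma_j\in\Sigma[x]_{2(d+\delta-v_j)}$, where $\sigma_j=0$ if $v_j>d+\delta$. - For a positive semidefinite $p\times p$ matrix $M$, $\phi_q(M)=\big(\tfrac1p\operatorname{trace}(M^q)\big)^{1/q}$ if $q>0$, or if $q<0$ and $M$ is positive definite; $\phi_0(M)=\det(M)^{1/p}$ if $M$ is positive definite; and $\phi_q(M)=0$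 if $q\le 0$ and $M$ is singular. - For $\mathbf y$ with $\mathbf M_d(\mathbf y)\succ0$, let $p^\star_{\mathbf y}=\operatorname{trace}(\mathbf M_d(\mathbf y)^q)-\mathbf F^{\top}\mathbf M_d(\mathbf y)^{q-1}\mathbf F\in\mathbb R[x]$. Consider the SDP relaxation of order $\delta$, $$\max_{\mathbf y}\ \phi_q(\mathbf M_d(\mathbf y))\quad\text{s.t.}\quad \mathbf y\in\mathcal M^{\mathsf{SDP}}_{2(d+\delta)}(\mathcal X),\ y_0=1.\qquad(\ast)$$ Then: a) Problem $(\ast)$ has an optimal solution. b) For every optimal solution $\mathbf y^\star$ of $(\ast)$, the matrix $\mathbf M_d(\mathbf y^\star)$ is positive definite, $p^\star_{\mathbf y^\star}\ge 0$ on $\mathcal X$, and $L_{\mathbf y^\star}(p^\star_{\mathbf y^\star})=0$. c) For every $\mathbf y\in\mathbb R^{\binom{n+2d}{n}}$ the following are equivalent: (i) $\mathbf y$ is an optimal solution of $(\ast)$; (ii) $\mathbf y\in\mathcal M^{\mathsf{SDP}}_{2(d+\delta)}(\mathcal X)$, $y_0=1$, $\mathbf M_d(\mathbf y)\succ 0$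 and $p^\star_{\mathbf y}\in\mathcal P^{\mathsf{SOS}}_{2(d+\delta)}(\mathcal X)$. d) If $\mathfrak A$ has full column rank $\binom{n+d}{n}$, the optimal solution of $(\ast)$ is unique. -/

import Mathlib

open MvPolynomial

namespace OptDesign

noncomputable section

/-- The multi-indices `α ∈ ℕⁿ` with `|α| ≤ k`; there are `binom (n + k) n` of them. -/
abbrev MultiIdx (n k : ℕ) : Type := {α : Fin n →₀ ℕ // α.degree ≤ k}

instance instFintypeMultiIdx (n k : ℕ) : Fintype (MultiIdx n k) :=
  (Finsupp.finite_of_degree_le (σ := Fin n) k).fintype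

/-- A multi-index of degree at most `k`, seen as one of degree at most `l`, for `k ≤ l`. -/
def MultiIdx.lift {n k l : ℕ} (h : k ≤ l) (α : MultiIdx n k) : MultiIdx n l :=
  ⟨α.1, α.2.trans h⟩

/-- The basic semi-algebraic set `{x ∈ ℝⁿ : g_j(x) ≥ 0, j = 1, …, m}`. -/
def designSpace {n m : ℕ} (g : Fin m → MvPolynomial (Fin n) ℝ) : Set (Fin n → ℝ) :=
  {x | ∀ j, 0 ≤ eval x (g j)}

/-- The functional `L_y (f) = ∑ f_α y_α` of a truncated sequence `y = (y_α)_{|α| ≤ k}`; it is used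
for polynomials `f` of degree at most `k`. -/
def riesz {n k : ℕ} (y : MultiIdx n k → ℝ) (f : MvPolynomial (Fin n) ℝ) : ℝ :=
  ∑ α : MultiIdx n k, coeff α.1 f * y α

/-- The localizing matrix `M_e(f y)`, with rows and columns indexed by `|α|, |β| ≤ e` and entries
`L_y (f x^α x^β)`. It is used for `deg f + 2 e ≤ k`. -/
def localizingMatrix {n k : ℕ} (e : ℕ) (f : MvPolynomial (Fin n) ℝ) (y : MultiIdx n k → ℝ) :
    Matrix (MultiIdx n e) (MultiIdx n e) ℝ :=
  fun α β => riesz y (f * monomial α.1 1 * monomial β.1 1)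

/-- The moment matrix `M_e(y)`, with entries `y_{α + β}` for `|α|, |β| ≤ e`. -/
def momentMatrix {n e : ℕ} (y : MultiIdx n (2 * e) → ℝ) :
    Matrix (MultiIdx n e) (MultiIdx n e) ℝ :=
  fun α β => y ⟨α.1 + β.1, by
    have h1 := α.2
    have h2 := β.2
    rw [map_add]
    omega⟩

/-- `⌈deg f / 2⌉`. -/
def halfDegree {n : ℕ} (f : MvPolynomial (Fin n) ℝ) : ℕ := (f.totalDegree + 1) / 2

/-- The cone `M_{2(d+δ)}^{SDP}`: the sequences `y = (y_α)_{|α| ≤ 2d}` that extend to a sequence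
`z = (z_α)_{|α| ≤ 2(d+δ)}` with `M_{d+δ}(z) ⪰ 0` and `M_{d+δ-v_j}(g_j z) ⪰ 0` for all `j`, where
`v_j = ⌈deg g_j / 2⌉`. If `d + δ < v_j`, the `j`-th localizing matrix is empty and imposes
nothing. -/
def sdpCone {n m : ℕ} (g : Fin m → MvPolynomial (Fin n) ℝ) (d δ : ℕ) :
    Set (MultiIdx n (2 * d) → ℝ) :=
  {y | ∃ z : MultiIdx n (2 * (d + δ)) → ℝ,
    (∀ α : MultiIdx n (2 * d), y α = z (α.lift (by omega))) ∧
    (momentMatrix z).PosSemidef ∧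
    ∀ j, halfDegree (g j) ≤ d + δ →
      (localizingMatrix (d + δ - halfDegree (g j)) (g j) z).PosSemidef}

/-- `Σ[x]_{2e}`: the sums of squares of polynomials of degree at most `e`. -/
def sosCone (n e : ℕ) : Set (MvPolynomial (Fin n) ℝ) :=
  {σ | ∃ (k : ℕ) (h : Fin k → MvPolynomial (Fin n) ℝ),
    (∀ i, (h i).totalDegree ≤ e) ∧ σ = ∑ i, h i ^ 2}

/-- The truncated quadratic module `P_{2(d+δ)}^{SOS}`: the polynomials
`h = σ_0 + ∑_j g_j σ_j` of degree at most `2d` with `σ_0 ∈ Σ[x]_{2(d+δ)}` and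
`σ_j ∈ Σ[x]_{2(d+δ-v_j)}`, where `σ_j = 0` if `d + δ < v_j`. -/
def quadModule {n m : ℕ} (g : Fin m → MvPolynomial (Fin n) ℝ) (d δ : ℕ) :
    Set (MvPolynomial (Fin n) ℝ) :=
  {h | h.totalDegree ≤ 2 * d ∧
    ∃ σ₀ ∈ sosCone n (d + δ), ∃ σ : Fin m → MvPolynomial (Fin n) ℝ,
      (∀ j, σ j ∈ sosCone n (d + δ - halfDegree (g j))) ∧
      (∀ j, d + δ < halfDegree (g j) → σ j = 0) ∧
      h = σ₀ + ∑ j, g j * σ j}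

/-- The real power `M ^ r` of a symmetric positive semidefinite matrix, obtained by applying
`t ↦ t ^ r` to the eigenvalues; for `r < 0` it is used for positive definite `M` only. -/
def matPow {p : ℕ} (M : Matrix (Fin p) (Fin p) ℝ) (r : ℝ) : Matrix (Fin p) (Fin p) ℝ :=
  cfc (fun t : ℝ => t ^ r) M

open Classical in
/-- Kiefer's criterion `φ_q` on positive semidefinite matrices of size `p`, for finite `q`. -/
def kiefer {p : ℕ} (q : ℝ) (M : Matrix (Fin p) (Fin p) ℝ) : ℝ :=
  if 0 < q then (1 / (p : ℝ) * (matPow M q).trace) ^ (1 / q)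
  else if M.PosDef then
    (if q = 0 then M.det ^ (1 / (p : ℝ)) else (1 / (p : ℝ) * (matPow M q).trace) ^ (1 / q))
  else 0

/-- The information matrix `𝔄 M_d(y) 𝔄ᵀ` of the regressors `F = 𝔄 v_d`. -/
def infoMatrix {n d p : ℕ} (A : Matrix (Fin p) (MultiIdx n d) ℝ) (y : MultiIdx n (2 * d) → ℝ) :
    Matrix (Fin p) (Fin p) ℝ :=
  A * momentMatrix y * A.transpose

/-- The regressors `F = 𝔄 v_d`, where `v_d` is the vector of all monomials of degree at most
`d`. -/
def regressor {n d p : ℕ} (A : Matrix (Fin p) (MultiIdx n d) ℝ) (i : Fin p) :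
    MvPolynomial (Fin n) ℝ :=
  ∑ α : MultiIdx n d, monomial α.1 (A i α)

/-- The polynomial `p_d^⋆ = Fᵀ 𝐌_d(y)^{q-1} F`. -/
def christoffel {n d p : ℕ} (q : ℝ) (A : Matrix (Fin p) (MultiIdx n d) ℝ)
    (y : MultiIdx n (2 * d) → ℝ) : MvPolynomial (Fin n) ℝ :=
  ∑ i, ∑ j, regressor A i * C (matPow (infoMatrix A y) (q - 1) i j) * regressor A j

/-- The polynomial `p^⋆ = trace (𝐌_d(y)^q) - p_d^⋆`. -/
def dualPoly {n d p : ℕ} (q : ℝ) (A : Matrix (Fin p) (MultiIdx n d) ℝ)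
    (y : MultiIdx n (2 * d) → ℝ) : MvPolynomial (Fin n) ℝ :=
  C (matPow (infoMatrix A y) q).trace - christoffel q A y

/-- The feasible set `{y ∈ M_{2(d+δ)}^{SDP} : y_0 = 1}` of the relaxation of order `δ`. -/
def feasibleSet {n m : ℕ} (g : Fin m → MvPolynomial (Fin n) ℝ) (d δ : ℕ) :
    Set (MultiIdx n (2 * d) → ℝ) :=
  {y | y ∈ sdpCone g d δ ∧ y ⟨0, by simp⟩ = 1}

/-- `y` is an optimal solution of the relaxation of order `δ`: it maximizes `φ_q (𝐌_d(y))` over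
the feasible set. -/
def IsOptimalSDP {n m d p : ℕ} (g : Fin m → MvPolynomial (Fin n) ℝ) (δ : ℕ) (q : ℝ)
    (A : Matrix (Fin p) (MultiIdx n d) ℝ) (y : MultiIdx n (2 * d) → ℝ) : Prop :=
  y ∈ feasibleSet g d δ ∧
    ∀ z ∈ feasibleSet g d δ, kiefer q (infoMatrix A z) ≤ kiefer q (infoMatrix A y)

end

end OptDesign

/-! ### Spectral calculus and trace inequalities for symmetric matrices -/

namespace OptDesign
open Matrix

/-! This is concave maximization over a compact convex set, followed by conic duality. Kiefer's
criterion is an increasing transform of `potential`, the trace of a strictly concave scalar function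
of `M`, with gradient `M ^ (q - 1)`. Klein's inequality `trace_cfc_le` lifts the scalar tangent
inequality to matrices, with equality only for equal matrices.

Existence follows from compactness: the ball constraint bounds all pseudo-moments
(`abs_le_of_mem_momentCone`). For `q ≤ 0` the potential tends to `-∞` at singular matrices, so a
superlevel set stays away from them. Nonempty interior and full row rank supply a feasible point
with positive definite information matrix. A maximizer is never singular (`posDef_of_kiefer_max`):
for `0 < q < 1` the slope of the potential towards that point would be infinite.

At a positive definite `M`, optimality is therefore equivalent to the first-order condition `tr (M ^
(q - 1) N) ≤ tr (M ^ q)` for all feasible `N`. By `riesz_dualPoly` this says `L_z (p⋆) ≥ 0` for all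
feasible `z`. Dirac measures give `p⋆ ≥ 0` on the design space, and `z = y` gives `L_y (p⋆) = 0`.

For the sum-of-squares certificate, nonnegativity passes to the whole cone, and the truncated
quadratic module is the dual of that cone. The latter rests on closedness of the module
(`isClosed_gramCoeff_image`), which comes from the nonempty interior, and on Hahn-Banach. Uniqueness
combines the equality case of Klein's inequality with injectivity of the map from moments to
information matrices. -/

/-- Two real symmetric matrices are simultaneously described by the spectra and the squared entries
of the orthogonal transition matrix between eigenbases. -/
theorem exists_trace_cfc_mul_cfc {p : ℕ} {M N : Matrix (Fin p) (Fin p) ℝ} (hM : M.IsHermitian)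
    (hN : N.IsHermitian) :
    ∃ s : Fin p → Fin p → ℝ, (∀ i j, 0 ≤ s i j) ∧
      (∀ f h : ℝ → ℝ, (cfc f M * cfc h N).trace =
        ∑ i, ∑ j, s i j * (f (hM.eigenvalues i) * h (hN.eigenvalues j))) ∧
      ((∀ i j, s i j = 0 ∨ hM.eigenvalues i = hN.eigenvalues j) → M = N) := by
  set U : Matrix (Fin p) (Fin p) ℝ := hM.eigenvectorUnitary.1 with hU
  set W : Matrix (Fin p) (Fin p) ℝ := hN.eigenvectorUnitary.1 with hW
  have hUU : U * star U = 1 := Unitary.coe_mul_star_self _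
  have hWW : W * star W = 1 := Unitary.coe_mul_star_self _
  have hMc : ∀ f : ℝ → ℝ, cfc f M = U * diagonal (f ∘ hM.eigenvalues) * star U := by
    intro f; rw [hM.cfc_eq, IsHermitian.cfc, Unitary.conjStarAlgAut_apply]; rfl
  have hNc : ∀ f : ℝ → ℝ, cfc f N = W * diagonal (f ∘ hN.eigenvalues) * star W := by
    intro f; rw [hN.cfc_eq, IsHermitian.cfc, Unitary.conjStarAlgAut_apply]; rfl
  set Q := star U * W with hQ
  have hQs : star Q = star W * U := by simp [hQ]
  refine ⟨fun i j => Q i j ^ 2, fun i j => sq_nonneg _, ?_, ?_⟩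
  · intro f h
    rw [hMc, hNc]
    have : (U * diagonal (f ∘ hM.eigenvalues) * star U *
        (W * diagonal (h ∘ hN.eigenvalues) * star W)).trace =
        (diagonal (f ∘ hM.eigenvalues) * Q * (diagonal (h ∘ hN.eigenvalues) * star Q)).trace := by
      rw [hQs]
      simp only [mul_assoc]
      rw [trace_mul_comm]
      simp only [hQ, mul_assoc]
    rw [this]
    simp only [trace, diag_apply, mul_apply, star_apply, star_trivial,
      Function.comp_apply, diagonal_apply, ite_mul, zero_mul, Finset.sum_ite_eq, Finset.mem_univ,
      if_true]
    refine Finset.sum_congr rfl fun i _ => Finset.sum_congr rfl fun j _ => ?_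
    ring
  · intro hs
    -- `Q` has nonzero entries only where the two spectra agree, so it intertwines the diagonal
    -- forms.
    have h1 : diagonal hM.eigenvalues * Q = Q * diagonal hN.eigenvalues := by
      ext i j
      rw [diagonal_mul, mul_diagonal]
      rcases hs i j with h | h
      · rw [pow_eq_zero_iff two_ne_zero] at h; simp [h]
      · rw [h, mul_comm]
    have hM1 : M = U * diagonal hM.eigenvalues * star U := by
      have := hM.spectral_theorem
      rwa [Unitary.conjStarAlgAut_apply] at this
    have hN1 : N = W * diagonal hN.eigenvalues * star W := by
      have := hN.spectral_theorem
      rwa [Unitary.conjStarAlgAut_apply] at this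
    calc M = U * (diagonal hM.eigenvalues * Q) * star W := by
          conv_lhs => rw [hM1]
          simp only [hQ, mul_assoc, hWW, mul_one]
      _ = N := by
          rw [h1]; conv_rhs => rw [hN1]
          simp only [hQ, ← mul_assoc, hUU, one_mul]

theorem trace_cfc {p : ℕ} {M : Matrix (Fin p) (Fin p) ℝ} (hM : M.IsHermitian) (f : ℝ → ℝ) :
    (cfc f M).trace = ∑ i, f (hM.eigenvalues i) := by
  rw [hM.cfc_eq, IsHermitian.cfc, Unitary.conjStarAlgAut_apply, trace_mul_cycle,
    Unitary.coe_star_mul_self, one_mul, trace_diagonal]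
  rfl

/-- Klein's inequality. -/
theorem trace_cfc_le {p : ℕ} {M N : Matrix (Fin p) (Fin p) ℝ} (hM : M.IsHermitian)
    (hN : N.IsHermitian) (f f' : ℝ → ℝ)
    (h : ∀ i j, f (hN.eigenvalues j) ≤ f (hM.eigenvalues i) +
      f' (hM.eigenvalues i) * (hN.eigenvalues j - hM.eigenvalues i)) :
    (cfc f N).trace ≤ (cfc f M).trace + (cfc f' M * (N - M)).trace ∧
    ((∀ i j, hM.eigenvalues i ≠ hN.eigenvalues j → f (hN.eigenvalues j) < f (hM.eigenvalues i) +
      f' (hM.eigenvalues i) * (hN.eigenvalues j - hM.eigenvalues i)) →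
      (cfc f N).trace = (cfc f M).trace + (cfc f' M * (N - M)).trace → M = N) := by
  obtain ⟨s, hs, ht, hMN⟩ := exists_trace_cfc_mul_cfc hM hN
  -- Inserting the constant function `1` for one factor expresses single-matrix traces with the same
  -- weights `s`, so the gap in Klein's inequality becomes a weighted sum of scalar tangent gaps.
  have hM1 : cfc (fun _ => (1 : ℝ)) M = 1 := cfc_const_one ℝ M hM
  have hN1 : cfc (fun _ => (1 : ℝ)) N = 1 := cfc_const_one ℝ N hN
  have hNid : cfc (fun x : ℝ => x) N = N := cfc_id' ℝ N hN
  have hMid : cfc (fun x : ℝ => x) M = M := cfc_id' ℝ M hM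
  have c1 : (cfc f N).trace = ∑ i, ∑ j, s i j * f (hN.eigenvalues j) := by
    have := ht (fun _ => 1) f
    rw [hM1, one_mul] at this
    rw [this]; simp
  have c2 : (cfc f M).trace = ∑ i, ∑ j, s i j * f (hM.eigenvalues i) := by
    have := ht f (fun _ => 1)
    rw [hN1, mul_one] at this
    rw [this]; simp
  have c3 : (cfc f' M * N).trace = ∑ i, ∑ j, s i j * (f' (hM.eigenvalues i) * hN.eigenvalues j) := by
    have := ht f' (fun x => x)
    rwa [hNid] at this
  have c4 : (cfc f' M * M).trace = ∑ i, ∑ j, s i j * (f' (hM.eigenvalues i) * hM.eigenvalues i) := by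
    have h1 : cfc f' M * M = cfc (fun x => f' x * x) M := by
      conv_lhs => rw [← hMid]
      rw [hMid]
      nth_rewrite 2 [← hMid]
      rw [← cfc_mul f' (fun x => x) M (Set.Finite.continuousOn finite_real_spectrum _)
        (Set.Finite.continuousOn finite_real_spectrum _)]
    have := ht (fun x => f' x * x) (fun _ => 1)
    rw [hN1, mul_one] at this
    rw [h1, this]; simp
  have key : (cfc f M).trace + (cfc f' M * (N - M)).trace - (cfc f N).trace =
      ∑ i, ∑ j, s i j * (f (hM.eigenvalues i) +
      f' (hM.eigenvalues i) * (hN.eigenvalues j - hM.eigenvalues i) - f (hN.eigenvalues j)) := by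
    rw [mul_sub, trace_sub, c1, c2, c3, c4]
    simp only [← Finset.sum_sub_distrib, ← Finset.sum_add_distrib]
    refine Finset.sum_congr rfl fun i _ => Finset.sum_congr rfl fun j _ => ?_
    ring
  have hnn : ∀ i j, 0 ≤ s i j * (f (hM.eigenvalues i) +
      f' (hM.eigenvalues i) * (hN.eigenvalues j - hM.eigenvalues i) - f (hN.eigenvalues j)) :=
    fun i j => mul_nonneg (hs i j) (by linarith [h i j])
  constructor
  · have : 0 ≤ ∑ i, ∑ j, s i j * (f (hM.eigenvalues i) +
      f' (hM.eigenvalues i) * (hN.eigenvalues j - hM.eigenvalues i) - f (hN.eigenvalues j)) :=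
      Finset.sum_nonneg fun i _ => Finset.sum_nonneg fun j _ => hnn i j
    linarith
  · intro hst heq
    apply hMN
    intro i j
    have h0 : ∑ i, ∑ j, s i j * (f (hM.eigenvalues i) +
      f' (hM.eigenvalues i) * (hN.eigenvalues j - hM.eigenvalues i) - f (hN.eigenvalues j)) = 0 := by
      linarith
    rw [Finset.sum_eq_zero_iff_of_nonneg fun i _ => Finset.sum_nonneg fun j _ => hnn i j] at h0
    have h1 := h0 i (Finset.mem_univ _)
    rw [Finset.sum_eq_zero_iff_of_nonneg fun j _ => hnn i j] at h1
    have h2 := h1 j (Finset.mem_univ _)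
    by_contra! hc
    have h3 := hst i j hc.2
    rcases mul_eq_zero.1 h2 with h4 | h4
    · exact hc.1 h4
    · linarith

/-- The functional calculus is continuous on bounded sets of symmetric matrices with a lower bound
on the spectrum. -/
theorem continuousOn_cfc_matrix {p : ℕ} {ε B : ℝ} {f : ℝ → ℝ} (hf : ContinuousOn f (Set.Icc ε B)) :
    ContinuousOn (fun M : Matrix (Fin p) (Fin p) ℝ => cfc f M)
      {M | M.IsHermitian ∧ spectrum ℝ M ⊆ Set.Icc ε B} := by
  open scoped Matrix.Norms.L2Operator in
  exact continuousOn_cfc (Matrix (Fin p) (Fin p) ℝ) isCompact_Icc f hf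

theorem eigenvalues_le_trace {p : ℕ} {M : Matrix (Fin p) (Fin p) ℝ} (hM : M.PosSemidef)
    (i : Fin p) : hM.1.eigenvalues i ≤ M.trace := by
  rw [hM.1.trace_eq_sum_eigenvalues]
  exact Finset.single_le_sum (f := fun i => hM.1.eigenvalues i)
    (fun j _ => hM.eigenvalues_nonneg j) (Finset.mem_univ i)

theorem spectrum_subset_Icc {p : ℕ} {ε B : ℝ} {M : Matrix (Fin p) (Fin p) ℝ}
    (hM : M.PosSemidef) (hε : (M - ε • (1 : Matrix (Fin p) (Fin p) ℝ)).PosSemidef) (hB : M.trace ≤ B) :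
    spectrum ℝ M ⊆ Set.Icc ε B := by
  rw [hM.1.spectrum_real_eq_range_eigenvalues]
  rintro _ ⟨i, rfl⟩
  constructor
  · have h1 := hM.1.mulVec_eigenvectorBasis i
    have h2 := hε.dotProduct_mulVec_nonneg (hM.1.eigenvectorBasis i : Fin p → ℝ)
    have h3 : (hM.1.eigenvectorBasis i : Fin p → ℝ) ⬝ᵥ (hM.1.eigenvectorBasis i : Fin p → ℝ) = 1 := by
      have := hM.1.eigenvectorBasis.orthonormal.1 i
      rw [EuclideanSpace.norm_eq, Real.sqrt_eq_one] at this
      simpa [dotProduct, sq] using this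
    rw [sub_mulVec, h1, smul_mulVec, one_mulVec, ← sub_smul, dotProduct_smul, star_trivial, h3] at h2
    simpa using h2
  · exact (eigenvalues_le_trace hM i).trans hB

theorem posSemidef_sub_smul_one {p : ℕ} {ε : ℝ} {M : Matrix (Fin p) (Fin p) ℝ}
    (hM : M.IsHermitian) (h : ∀ i, ε ≤ hM.eigenvalues i) :
    (M - ε • (1 : Matrix (Fin p) (Fin p) ℝ)).PosSemidef := by
  set U : Matrix (Fin p) (Fin p) ℝ := hM.eigenvectorUnitary.1 with hU
  have hUU : U * star U = 1 := Unitary.coe_mul_star_self _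
  have hM1 : M = U * diagonal hM.eigenvalues * star U := by
    have := hM.spectral_theorem
    rwa [Unitary.conjStarAlgAut_apply] at this
  have : M - ε • (1 : Matrix (Fin p) (Fin p) ℝ) =
      U * diagonal (fun i => hM.eigenvalues i - ε) * Uᴴ := by
    have hd : diagonal (fun i => hM.eigenvalues i - ε) =
        diagonal hM.eigenvalues - ε • (1 : Matrix (Fin p) (Fin p) ℝ) := by
      ext i j
      by_cases hij : i = j <;> simp [hij, diagonal]
    rw [hd, mul_sub, sub_mul, ← star_eq_conjTranspose, ← hM1]
    simp [hUU]
  rw [this]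
  exact (PosSemidef.diagonal fun i => sub_nonneg.2 (h i)).mul_mul_conjTranspose_same U

end OptDesign

/-! ### Kiefer's criterion as a transform of a strictly concave potential -/

namespace OptDesign
open Matrix

/-- The concave function whose trace functional is an increasing transform of Kiefer's criterion. -/
noncomputable def kieferFun (q t : ℝ) : ℝ := if q = 0 then Real.log t else t ^ q / q

/-- The increasing transform `tr (M ^ q) / q`, or `log det M`, of Kiefer's criterion. -/
noncomputable def potential {p : ℕ} (q : ℝ) (M : Matrix (Fin p) (Fin p) ℝ) : ℝ :=
  (cfc (kieferFun q) M).trace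

/-- Scaling by `a` reduces to `u = b / a` against the base point `1`: `log u < u - 1` for `q = 0`,
that bound combined with `1 + s ≤ exp s` for `q < 0`, and Bernoulli's inequality for `0 < q < 1`.
Only the last case tolerates `b = 0`. -/
theorem kieferFun_lt_tangent {q a b : ℝ} (hq : q < 1) (ha : 0 < a) (hb : 0 ≤ b)
    (hb' : q ≤ 0 → 0 < b) (hab : a ≠ b) :
    kieferFun q b < kieferFun q a + a ^ (q - 1) * (b - a) := by
  have hu : b / a ≠ 1 := fun h => hab ((div_eq_one_iff_eq ha.ne').1 h).symm
  unfold kieferFun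
  split_ifs with h0
  · have hb0 := hb' h0.le
    have := Real.log_lt_sub_one_of_pos (div_pos hb0 ha) hu
    rw [Real.log_div hb0.ne' ha.ne'] at this
    have h2 : a ^ (q - 1) * (b - a) = b / a - 1 := by
      rw [h0, zero_sub, Real.rpow_neg_one]; field_simp
    linarith
  · have hpow : b ^ q = a ^ q * (b / a) ^ q := by
      rw [Real.div_rpow hb ha.le, mul_div_cancel₀ _ (Real.rpow_pos_of_pos ha q).ne']
    have h2 : a ^ (q - 1) * (b - a) = a ^ q * (b / a - 1) := by
      rw [Real.rpow_sub_one ha.ne']; field_simp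
    have key : (b / a) ^ q / q < 1 / q + (b / a - 1) := by
      rcases lt_or_gt_of_ne h0 with hn | hp
      · have hb0 := hb' hn.le
        have hua := div_pos hb0 ha
        have h3 := Real.log_lt_sub_one_of_pos hua hu
        have h4 := Real.add_one_le_exp (Real.log (b / a) * q)
        rw [← Real.rpow_def_of_pos hua] at h4
        have h5 : (b / a) ^ q > 1 + q * (b / a - 1) := by nlinarith
        rw [div_lt_iff_of_neg hn]
        have : (1 / q + (b / a - 1)) * q = 1 + q * (b / a - 1) := by field_simp
        linarith
      · have h3 := rpow_one_add_lt_one_add_mul_self (s := b / a - 1) (p := q)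
          (by have := div_nonneg hb ha.le; linarith) (sub_ne_zero.2 hu) hp hq
        rw [add_sub_cancel] at h3
        rw [div_lt_iff₀ hp]
        have : (1 / q + (b / a - 1)) * q = 1 + q * (b / a - 1) := by field_simp
        linarith
    rw [hpow, h2, mul_div_assoc]
    have h4 := mul_lt_mul_of_pos_left key (Real.rpow_pos_of_pos ha q)
    calc _ < _ := h4
      _ = _ := by ring

variable {p : ℕ} {q : ℝ} {M N : Matrix (Fin p) (Fin p) ℝ}

theorem potential_le (hq : q < 1) (hM : M.PosDef) (hN : N.PosSemidef) (hN' : q ≤ 0 → N.PosDef) :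
    potential q N ≤ potential q M + (matPow M (q - 1) * (N - M)).trace ∧
    (potential q N = potential q M + (matPow M (q - 1) * (N - M)).trace → M = N) := by
  have hpos : ∀ i, q ≤ 0 → 0 < hN.1.eigenvalues i := fun i h => (hN' h).eigenvalues_pos i
  have h := trace_cfc_le hM.1 hN.1 (kieferFun q) (fun t => t ^ (q - 1)) (by
    intro i j
    by_cases hij : hM.1.eigenvalues i = hN.1.eigenvalues j
    · simp [hij]
    · exact (kieferFun_lt_tangent hq (hM.eigenvalues_pos i) (hN.eigenvalues_nonneg j)
        (hpos j) hij).le)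
  exact ⟨h.1, h.2 fun i j hij => kieferFun_lt_tangent hq (hM.eigenvalues_pos i)
    (hN.eigenvalues_nonneg j) (hpos j) hij⟩

theorem trace_matPow (hM : M.IsHermitian) (hq : q ≠ 0) : (matPow M q).trace = q * potential q M := by
  rw [matPow, potential, trace_cfc hM, trace_cfc hM, Finset.mul_sum]
  refine Finset.sum_congr rfl fun i _ => ?_
  rw [kieferFun, if_neg hq]; field_simp

theorem trace_matPow_nonneg (hM : M.PosSemidef) (r : ℝ) : 0 ≤ (matPow M r).trace := by
  rw [matPow, trace_cfc hM.1]
  exact Finset.sum_nonneg fun i _ => Real.rpow_nonneg (hM.eigenvalues_nonneg i) _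

theorem trace_matPow_pos (hp : 0 < p) (hM : M.PosDef) (r : ℝ) : 0 < (matPow M r).trace := by
  have : Nonempty (Fin p) := ⟨⟨0, hp⟩⟩
  rw [matPow, trace_cfc hM.1]
  exact Finset.sum_pos (fun i _ => Real.rpow_pos_of_pos (hM.eigenvalues_pos i) _)
    Finset.univ_nonempty

theorem potential_zero (hM : M.PosDef) : potential 0 M = Real.log M.det := by
  rw [potential, trace_cfc hM.1, hM.1.det_eq_prod_eigenvalues]
  simp only [kieferFun, if_true, RCLike.ofReal_real_eq_id, id]
  rw [Real.log_prod fun i _ => (hM.eigenvalues_pos i).ne']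

/-- For `q < 0` two order reversals cancel: that of `t ↦ t ^ (1 / q)` and that of the division by
`q` in the potential. -/
theorem kiefer_le_kiefer_iff (hp : 0 < p) (hM : M.PosSemidef) (hM' : q ≤ 0 → M.PosDef)
    (hN : N.PosSemidef) (hN' : q ≤ 0 → N.PosDef) :
    kiefer q N ≤ kiefer q M ↔ potential q N ≤ potential q M := by
  have hp' : (0 : ℝ) < 1 / p := by positivity
  rcases lt_trichotomy q 0 with h | h | h
  · have h1 := hM' h.le
    have h2 := hN' h.le
    simp only [kiefer, not_lt.2 h.le, h1, h2, h.ne, if_true, if_false]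
    rw [Real.rpow_le_rpow_iff_of_neg (mul_pos hp' (trace_matPow_pos hp h2 q))
      (mul_pos hp' (trace_matPow_pos hp h1 q)) (by simpa using h), mul_le_mul_iff_right₀ hp',
      trace_matPow hN.1 h.ne, trace_matPow hM.1 h.ne, mul_le_mul_left_of_neg h]
  · have h1 := hM' h.le
    have h2 := hN' h.le
    subst h
    simp only [kiefer, lt_irrefl, h1, h2, if_true, if_false]
    rw [Real.rpow_le_rpow_iff h2.det_pos.le h1.det_pos.le hp', potential_zero h1,
      potential_zero h2, Real.log_le_log_iff h2.det_pos h1.det_pos]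
  · simp only [kiefer, h, if_true]
    rw [Real.rpow_le_rpow_iff (mul_nonneg hp'.le (trace_matPow_nonneg hN q))
      (mul_nonneg hp'.le (trace_matPow_nonneg hM q)) (by positivity), mul_le_mul_iff_right₀ hp',
      trace_matPow hN.1 h.ne', trace_matPow hM.1 h.ne', mul_le_mul_iff_right₀ h]

theorem kiefer_pos (hp : 0 < p) (hM : M.PosDef) : 0 < kiefer q M := by
  have hp' : (0 : ℝ) < 1 / p := by positivity
  unfold kiefer
  split_ifs
  · exact Real.rpow_pos_of_pos (mul_pos hp' (trace_matPow_pos hp hM q)) _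
  · exact Real.rpow_pos_of_pos hM.det_pos _
  · exact Real.rpow_pos_of_pos (mul_pos hp' (trace_matPow_pos hp hM q)) _

theorem kiefer_of_not_posDef (hq : q ≤ 0) (hM : ¬ M.PosDef) : kiefer q M = 0 := by
  simp [kiefer, hM, hq]

end OptDesign

/-! ### Behaviour of the potential near singular matrices -/

namespace OptDesign
open Matrix Filter Topology

theorem isClosed_setOf_posSemidef {ι : Type*} [Fintype ι] :
    IsClosed {M : Matrix ι ι ℝ | M.PosSemidef} := by
  have : {M : Matrix ι ι ℝ | M.PosSemidef} =
      {M | Mᴴ = M} ∩ ⋂ x : ι → ℝ, {M | 0 ≤ star x ⬝ᵥ (M *ᵥ x)} := by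
    ext M
    simp only [Set.mem_ofPred_eq, posSemidef_iff_dotProduct_mulVec, Set.mem_inter_iff,
      Set.mem_iInter]
    rfl
  rw [this]
  refine (isClosed_eq (by fun_prop) continuous_id).inter (isClosed_iInter fun x => ?_)
  exact isClosed_le continuous_const (by fun_prop)

theorem exists_pos_lt_of_tendsto_atBot {f : ℝ → ℝ} (hf : Tendsto f (𝓝[>] 0) atBot) (c : ℝ) :
    ∃ ε > 0, ∀ t, 0 < t → c ≤ f t → ε ≤ t := by
  have h := hf.eventually (eventually_lt_atBot c)
  obtain ⟨ε, hε, h⟩ := (mem_nhdsGT_iff_exists_Ioo_subset).1 h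
  refine ⟨ε, hε, fun t ht hc => ?_⟩
  by_contra! hlt
  exact absurd hc (not_le.2 (h ⟨ht, hlt⟩))

theorem tendsto_rpow_neg_nhdsGT_zero {r : ℝ} (hr : r < 0) :
    Tendsto (fun t : ℝ => t ^ r) (𝓝[>] 0) atTop := by
  have h := (tendsto_rpow_atTop (neg_pos.2 hr)).comp tendsto_inv_nhdsGT_zero
  refine h.congr' ?_
  filter_upwards [self_mem_nhdsWithin] with t ht
  simp only [Function.comp_apply]
  rw [Real.inv_rpow (le_of_lt ht), Real.rpow_neg (le_of_lt ht), inv_inv]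

theorem tendsto_kieferFun {q : ℝ} (hq : q ≤ 0) : Tendsto (kieferFun q) (𝓝[>] 0) atBot := by
  rcases eq_or_lt_of_le hq with h | h
  · have : kieferFun q = Real.log := by ext t; simp [kieferFun, h]
    rw [this]; exact Real.tendsto_log_nhdsGT_zero
  · have : kieferFun q = fun t => t ^ q / q := by ext t; simp [kieferFun, h.ne]
    rw [this]; exact (tendsto_rpow_neg_nhdsGT_zero h).atTop_div_const_of_neg h

theorem kieferFun_mono {q a b : ℝ} (hq : q ≤ 0) (ha : 0 < a) (hab : a ≤ b) :
    kieferFun q a ≤ kieferFun q b := by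
  unfold kieferFun
  split_ifs with h
  · exact Real.log_le_log ha hab
  · exact div_le_div_of_nonpos_of_le hq (Real.rpow_le_rpow_of_nonpos ha hab hq)

/-- The trace bound caps the contribution of every other eigenvalue, so a single eigenvalue near
zero would drag the potential below `s`. -/
theorem exists_le_of_potential_ge (p : ℕ) {q : ℝ} (hq : q ≤ 0) (s B : ℝ) :
    ∃ ε : ℝ, 0 < ε ∧ ∀ M : Matrix (Fin p) (Fin p) ℝ, M.PosDef → M.trace ≤ B → s ≤ potential q M →
      (M - ε • (1 : Matrix (Fin p) (Fin p) ℝ)).PosSemidef := by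
  obtain ⟨ε, hε, h⟩ := exists_pos_lt_of_tendsto_atBot (tendsto_kieferFun hq)
    (s - p * |kieferFun q B|)
  refine ⟨ε, hε, fun M hM hB hs => posSemidef_sub_smul_one hM.1 fun i => ?_⟩
  refine h _ (hM.eigenvalues_pos i) ?_
  rw [potential, trace_cfc hM.1, ← Finset.add_sum_erase _ _ (Finset.mem_univ i)] at hs
  have h1 : ∑ j ∈ Finset.univ.erase i, kieferFun q (hM.1.eigenvalues j) ≤
      ∑ j ∈ Finset.univ.erase i, |kieferFun q B| :=
    Finset.sum_le_sum fun j _ => (kieferFun_mono hq (hM.eigenvalues_pos j)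
      ((eigenvalues_le_trace hM.posSemidef j).trans hB)).trans (le_abs_self _)
  have h2 : ∑ j ∈ Finset.univ.erase i, |kieferFun q B| ≤ ∑ j : Fin p, |kieferFun q B| :=
    Finset.sum_le_sum_of_subset_of_nonneg (Finset.subset_univ _) fun _ _ _ => abs_nonneg _
  simp only [Finset.sum_const, Finset.card_univ, Fintype.card_fin, nsmul_eq_mul] at h2
  simp only [Finset.sum_const, nsmul_eq_mul] at h1
  linarith

theorem continuousOn_potential {p : ℕ} {q ε B : ℝ} (h : q ≤ 0 → 0 < ε) :
    ContinuousOn (potential (p := p) q) {M | M.PosSemidef ∧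
      (M - ε • (1 : Matrix (Fin p) (Fin p) ℝ)).PosSemidef ∧ M.trace ≤ B} := by
  have hf : ContinuousOn (kieferFun q) (Set.Icc ε B) := by
    unfold kieferFun
    split_ifs with h0
    · exact Real.continuousOn_log.mono fun t ht => ((h h0.le).trans_le ht.1).ne'
    · refine ContinuousOn.div_const (continuousOn_id.rpow_const fun t ht => ?_) _
      rcases lt_or_ge 0 q with hq | hq
      · exact Or.inr hq.le
      · exact Or.inl ((h hq).trans_le ht.1).ne'
  have hsub : {M | M.PosSemidef ∧ (M - ε • (1 : Matrix (Fin p) (Fin p) ℝ)).PosSemidef ∧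
      M.trace ≤ B} ⊆ {M | M.IsHermitian ∧ spectrum ℝ M ⊆ Set.Icc ε B} :=
    fun M hM => ⟨hM.1.1, spectrum_subset_Icc hM.1 hM.2.1 hM.2.2⟩
  have htr : Continuous (Matrix.trace : Matrix (Fin p) (Fin p) ℝ → ℝ) := by fun_prop
  exact htr.comp_continuousOn ((continuousOn_cfc_matrix (p := p) hf).mono hsub)

theorem exists_smul_one_le {p : ℕ} {M : Matrix (Fin p) (Fin p) ℝ} (hM : M.PosDef) :
    ∃ ε : ℝ, 0 < ε ∧ (M - ε • (1 : Matrix (Fin p) (Fin p) ℝ)).PosSemidef := by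
  rcases isEmpty_or_nonempty (Fin p) with h | h
  · exact ⟨1, one_pos, posSemidef_sub_smul_one hM.1 fun i => h.elim i⟩
  · obtain ⟨i, hi⟩ := Finite.exists_min hM.1.eigenvalues
    exact ⟨_, hM.eigenvalues_pos i, posSemidef_sub_smul_one hM.1 hi⟩

theorem posDef_of_sub_smul_one {p : ℕ} {M : Matrix (Fin p) (Fin p) ℝ} {ε : ℝ} (hε : 0 < ε)
    (h : (M - ε • (1 : Matrix (Fin p) (Fin p) ℝ)).PosSemidef) : M.PosDef := by
  have := (PosDef.one (n := Fin p) (R := ℝ)).smul hε |>.posSemidef_add h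
  simpa using this

theorem trace_matPow_mul_nonneg {p : ℕ} {M N : Matrix (Fin p) (Fin p) ℝ} (hM : M.PosSemidef)
    (hN : N.PosSemidef) (r : ℝ) : 0 ≤ (matPow M r * N).trace := by
  obtain ⟨s, hs, ht, -⟩ := exists_trace_cfc_mul_cfc hM.1 hN.1
  have := ht (fun t => t ^ r) (fun t => t)
  have hid : cfc (fun x : ℝ => x) N = N := cfc_id' ℝ N hN.1
  rw [hid] at this
  rw [matPow, this]
  exact Finset.sum_nonneg fun i _ => Finset.sum_nonneg fun j _ => mul_nonneg (hs i j)
    (mul_nonneg (Real.rpow_nonneg (hM.eigenvalues_nonneg i) _) (hN.eigenvalues_nonneg j))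

theorem matPow_sub_one_mul_self {p : ℕ} {M : Matrix (Fin p) (Fin p) ℝ} (hM : M.PosDef) (q : ℝ) :
    matPow M (q - 1) * M = matPow M q := by
  have h : cfc (fun x : ℝ => x) M = M := cfc_id' ℝ M hM.1
  rw [matPow, matPow]
  nth_rewrite 2 [← h]
  rw [← cfc_mul _ (fun x => x) M (Set.Finite.continuousOn finite_real_spectrum _)
    (Set.Finite.continuousOn finite_real_spectrum _)]
  refine cfc_congr fun t ht => ?_
  rw [hM.1.spectrum_real_eq_range_eigenvalues] at ht
  obtain ⟨i, rfl⟩ := ht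
  have := hM.eigenvalues_pos i
  change _ ^ (q - 1) * _ = _
  rw [Real.rpow_sub_one this.ne', div_mul_cancel₀ _ this.ne']

/-! ### Maximizing the criterion over a compact or convex set of matrices -/

section Optimization

variable {p : ℕ} {q : ℝ} {K : Set (Matrix (Fin p) (Fin p) ℝ)} {M N N₀ : Matrix (Fin p) (Fin p) ℝ}

theorem exists_kiefer_max (hp : 0 < p) (hK : IsCompact K) (hpsd : ∀ M ∈ K, M.PosSemidef)
    (hN₀ : N₀ ∈ K) (hN₀' : N₀.PosDef) : ∃ M ∈ K, ∀ N ∈ K, kiefer q N ≤ kiefer q M := by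
  obtain ⟨B, hB⟩ := hK.exists_bound_of_continuousOn (f := Matrix.trace)
    continuous_id.matrix_trace.continuousOn
  have hB' : ∀ M ∈ K, M.trace ≤ B := fun M hM => (le_abs_self _).trans (hB M hM)
  -- The superlevel set of `N₀` lies in a region where the potential is continuous. For `q > 0`
  -- continuity reaches the singular matrices and `ε = 0` suffices.
  obtain ⟨ε, hε', h⟩ : ∃ ε : ℝ, (q ≤ 0 → 0 < ε) ∧
      ∀ M ∈ K, (q ≤ 0 → M.PosDef) → potential q N₀ ≤ potential q M →
        (M - ε • (1 : Matrix (Fin p) (Fin p) ℝ)).PosSemidef := by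
    rcases lt_or_ge 0 q with hq | hq
    · exact ⟨0, fun h => absurd hq (not_lt.2 h), fun M hM _ _ => by simpa using hpsd M hM⟩
    · obtain ⟨ε, hε, h⟩ := exists_le_of_potential_ge p hq (potential q N₀) B
      exact ⟨ε, fun _ => hε, fun M hM hM' => h M (hM' hq) (hB' M hM)⟩
  have hKc : IsCompact (K ∩ {M | (M - ε • (1 : Matrix (Fin p) (Fin p) ℝ)).PosSemidef}) :=
    hK.inter_right (isClosed_setOf_posSemidef.preimage (by fun_prop))
  obtain ⟨M, hM, hmax⟩ := hKc.exists_isMaxOn ⟨N₀, hN₀, h N₀ hN₀ (fun _ => hN₀') le_rfl⟩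
    ((continuousOn_potential (p := p) (q := q) (B := B) hε').mono
      fun M hM => ⟨hpsd M hM.1, hM.2, hB' M hM.1⟩)
  have hM' : q ≤ 0 → M.PosDef := fun hq => posDef_of_sub_smul_one (hε' hq) hM.2
  have hMN₀ : potential q N₀ ≤ potential q M :=
    hmax ⟨hN₀, h N₀ hN₀ (fun _ => hN₀') le_rfl⟩
  refine ⟨M, hM.1, fun N hN => ?_⟩
  by_cases hN' : q ≤ 0 → N.PosDef
  · rw [kiefer_le_kiefer_iff hp (hpsd M hM.1) hM' (hpsd N hN) hN']
    rcases le_total (potential q N₀) (potential q N) with h1 | h1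
    · exact hmax ⟨hN, h N hN hN' h1⟩
    · exact h1.trans hMN₀
  · push Not at hN'
    rw [kiefer_of_not_posDef hN'.1 hN'.2]
    exact (kiefer_pos hp (hM' hN'.1)).le

/-- The tangent is taken at an interior point of the segment, since `M` itself may be singular. It
bounds the potential at `M` from above, while maximality of `M` bounds it from below by the value at
that interior point. -/
theorem trace_matPow_segment_le (hp : 0 < p) (hq : q < 1) (hc : Convex ℝ K)
    (hpsd : ∀ M ∈ K, M.PosSemidef) (hM : M ∈ K) (hM' : q ≤ 0 → M.PosDef)
    (hmax : ∀ N ∈ K, kiefer q N ≤ kiefer q M) (hN : N ∈ K) {t : ℝ} (ht : t ∈ Set.Ioo (0 : ℝ) 1)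
    (hpd : ((1 - t) • M + t • N).PosDef) :
    (matPow ((1 - t) • M + t • N) (q - 1) * N).trace ≤
      (matPow ((1 - t) • M + t • N) (q - 1) * M).trace := by
  have hmem : (1 - t) • M + t • N ∈ K := hc hM hN (by linarith [ht.2]) ht.1.le (by ring)
  have h1 := (potential_le hq hpd (hpsd M hM) hM').1
  have h2 := (kiefer_le_kiefer_iff hp (hpsd M hM) hM' hpd.posSemidef fun _ => hpd).1 (hmax _ hmem)
  have h3 : M - ((1 - t) • M + t • N) = t • (M - N) := by module
  rw [h3, Matrix.mul_smul, trace_smul, mul_sub, trace_sub, smul_eq_mul] at h1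
  have h4 := ht.1
  by_contra! hlt
  nlinarith

theorem posDef_segment (hM : M.PosSemidef) (hN : N.PosDef) {t : ℝ} (ht : t ∈ Set.Ioo (0 : ℝ) 1) :
    ((1 - t) • M + t • N).PosDef :=
  (hN.smul ht.1).posSemidef_add (hM.smul (by linarith [ht.2]))

theorem posDef_segment' (hM : M.PosDef) (hN : N.PosSemidef) {t : ℝ} (ht : t ∈ Set.Ioo (0 : ℝ) 1) :
    ((1 - t) • M + t • N).PosDef :=
  (hM.smul (by linarith [ht.2])).add_posSemidef (hN.smul ht.1.le)

/-- For `q > 0`, the segment `Mt` from `M` to `N₀` is bounded below uniformly in `t`. With `N₀ ⪰ c`,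
one has `c tr (Mt ^ (q - 1)) ≤ tr (Mt ^ (q - 1) N₀) ≤ tr (Mt ^ q) ≤ C`, where the middle inequality
averages the segment inequality. As `q - 1 < 0`, eigenvalues of `Mt` cannot approach zero, and the
bound survives `t → 0`. -/
theorem posDef_of_kiefer_max (hp : 0 < p) (hq : q < 1) (hc : Convex ℝ K)
    (hpsd : ∀ M ∈ K, M.PosSemidef) (hN₀ : N₀ ∈ K) (hN₀' : N₀.PosDef) (hM : M ∈ K)
    (hmax : ∀ N ∈ K, kiefer q N ≤ kiefer q M) : M.PosDef := by
  have hM' : q ≤ 0 → M.PosDef := by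
    intro h
    by_contra hn
    have := hmax N₀ hN₀
    rw [kiefer_of_not_posDef h hn] at this
    exact absurd (kiefer_pos hp hN₀') (not_lt.2 this)
  rcases le_or_gt q 0 with hq0 | hq0
  · exact hM' hq0
  obtain ⟨c, hc0, hc'⟩ := exists_smul_one_le hN₀'
  set C := q * potential q M
  obtain ⟨ε, hε, h⟩ := exists_pos_lt_of_tendsto_atBot (f := fun t => -t ^ (q - 1))
    (tendsto_neg_atTop_atBot.comp (tendsto_rpow_neg_nhdsGT_zero (by linarith))) (-(C / c))
  have key : ∀ t ∈ Set.Ioo (0 : ℝ) 1,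
      (((1 - t) • M + t • N₀) - ε • (1 : Matrix (Fin p) (Fin p) ℝ)).PosSemidef := by
    intro t ht
    have hpd := posDef_segment (hpsd M hM) hN₀' ht
    have hle := trace_matPow_segment_le hp hq hc hpsd hM hM' hmax hN₀ ht hpd
    have hmem : (1 - t) • M + t • N₀ ∈ K := hc hM hN₀ (by linarith [ht.2]) ht.1.le (by ring)
    have h2 := (kiefer_le_kiefer_iff hp (hpsd M hM) hM' hpd.posSemidef fun _ => hpd).1
      (hmax _ hmem)
    set Mt := (1 - t) • M + t • N₀ with hMt
    refine posSemidef_sub_smul_one hpd.1 fun i => h _ (hpd.eigenvalues_pos i) ?_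
    have h3 : (matPow Mt (q - 1) * Mt).trace ≤ C := by
      rw [matPow_sub_one_mul_self hpd, trace_matPow hpd.1 hq0.ne']
      exact mul_le_mul_of_nonneg_left h2 hq0.le
    have h4 : (matPow Mt (q - 1) * Mt).trace =
        (1 - t) * (matPow Mt (q - 1) * M).trace + t * (matPow Mt (q - 1) * N₀).trace := by
      conv_lhs => rw [hMt]
      rw [← hMt, mul_add, trace_add, Matrix.mul_smul, Matrix.mul_smul, trace_smul, trace_smul, smul_eq_mul,
        smul_eq_mul]
    have h5 := trace_matPow_mul_nonneg hpd.posSemidef hc' (q - 1)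
    rw [mul_sub, trace_sub, Matrix.mul_smul, mul_one, trace_smul, smul_eq_mul] at h5
    have h6 : hpd.1.eigenvalues i ^ (q - 1) ≤ (matPow Mt (q - 1)).trace := by
      rw [matPow, trace_cfc hpd.1]
      exact Finset.single_le_sum (f := fun i => hpd.1.eigenvalues i ^ (q - 1))
        (fun j _ => Real.rpow_nonneg (hpd.eigenvalues_pos j).le _) (Finset.mem_univ i)
    rw [neg_le_neg_iff, le_div_iff₀ hc0]
    have h7 := mul_le_mul_of_nonneg_left hle (by linarith [ht.2] : 0 ≤ 1 - t)
    nlinarith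
  refine posDef_of_sub_smul_one hε ?_
  have hcont : Tendsto (fun t : ℝ => ((1 - t) • M + t • N₀) - ε • (1 : Matrix (Fin p) (Fin p) ℝ))
      (𝓝[>] 0) (𝓝 (M - ε • (1 : Matrix (Fin p) (Fin p) ℝ))) := by
    have : Continuous (fun t : ℝ => ((1 - t) • M + t • N₀) - ε • (1 : Matrix (Fin p) (Fin p) ℝ)) := by
      fun_prop
    have := (this.tendsto 0).mono_left (nhdsWithin_le_nhds (s := Set.Ioi 0))
    simpa using this
  exact isClosed_setOf_posSemidef.mem_of_tendsto hcont
    (eventually_of_mem (Ioo_mem_nhdsGT one_pos) key)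

/-- The segment inequality passes to the limit `t → 0`. For `t ≤ 1 / 2` the segment stays above `ε /
2`, where the power `q - 1` is continuous. -/
theorem trace_le_of_kiefer_max (hp : 0 < p) (hq : q < 1) (hc : Convex ℝ K)
    (hpsd : ∀ M ∈ K, M.PosSemidef) (hM : M ∈ K) (hM' : M.PosDef)
    (hmax : ∀ N ∈ K, kiefer q N ≤ kiefer q M) (hN : N ∈ K) :
    (matPow M (q - 1) * N).trace ≤ (matPow M q).trace := by
  obtain ⟨ε, hε, hM2⟩ := exists_smul_one_le hM'
  set γ : ℝ → Matrix (Fin p) (Fin p) ℝ := fun t => (1 - t) • M + t • N with hγ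
  have hγ0 : γ 0 = M := by simp [hγ]
  have hf : ContinuousOn (fun t : ℝ => t ^ (q - 1)) (Set.Icc (ε / 2) (M.trace + N.trace)) :=
    continuousOn_id.rpow_const fun t ht => Or.inl ((half_pos hε).trans_le ht.1).ne'
  have hmem : ∀ t ∈ Set.Icc (0 : ℝ) (1 / 2), (γ t).PosSemidef ∧
      (γ t - (ε / 2) • (1 : Matrix (Fin p) (Fin p) ℝ)).PosSemidef ∧
      (γ t).trace ≤ M.trace + N.trace := by
    intro t ht
    have hN0 := hpsd N hN
    refine ⟨(hM'.posSemidef.smul (by linarith [ht.2])).add (hN0.smul ht.1), ?_, ?_⟩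
    · have : γ t - (ε / 2) • (1 : Matrix (Fin p) (Fin p) ℝ) =
          (1 - t) • (M - ε • (1 : Matrix (Fin p) (Fin p) ℝ)) + t • N +
            (ε * (1 / 2 - t)) • (1 : Matrix (Fin p) (Fin p) ℝ) := by
        simp only [hγ]; module
      rw [this]
      exact ((hM2.smul (by linarith [ht.2])).add (hN0.smul ht.1)).add
        (PosSemidef.one.smul (mul_nonneg hε.le (by linarith [ht.2])))
    · have h1 := hM'.posSemidef.trace_nonneg
      have h2 := hN0.trace_nonneg
      simp only [hγ, trace_add, trace_smul, smul_eq_mul]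
      nlinarith [ht.1, ht.2]
  have hcfc : ContinuousOn (fun t => cfc (fun x : ℝ => x ^ (q - 1)) (γ t)) (Set.Icc 0 (1 / 2)) :=
    (continuousOn_cfc_matrix hf).comp (by fun_prop) fun t ht =>
      ⟨(hmem t ht).1.1, spectrum_subset_Icc (hmem t ht).1 (hmem t ht).2.1 (hmem t ht).2.2⟩
  have hlim : ∀ H : Matrix (Fin p) (Fin p) ℝ, Tendsto (fun t => (matPow (γ t) (q - 1) * H).trace)
      (𝓝[>] 0) (𝓝 (matPow M (q - 1) * H).trace) := by
    intro H
    have h1 := (hcfc 0 (by norm_num)).tendsto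
    rw [hγ0] at h1
    have h2 : Continuous (fun G : Matrix (Fin p) (Fin p) ℝ => (G * H).trace) := by fun_prop
    refine ((h2.tendsto _).comp h1).mono_left ?_
    exact nhdsWithin_le_of_mem (mem_of_superset (Ioo_mem_nhdsGT (by norm_num : (0 : ℝ) < 1 / 2))
      Set.Ioo_subset_Icc_self)
  rw [← matPow_sub_one_mul_self hM' q]
  refine le_of_tendsto_of_tendsto (hlim N) (hlim M)
    (eventually_of_mem (Ioo_mem_nhdsGT one_pos) fun t ht => ?_)
  exact trace_matPow_segment_le hp hq hc hpsd hM (fun _ => hM') hmax hN ht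
    (posDef_segment' hM' (hpsd N hN) ht)

theorem kiefer_le_of_trace_le (hp : 0 < p) (hq : q < 1) (hM : M.PosDef) (hN : N.PosSemidef)
    (h : (matPow M (q - 1) * N).trace ≤ (matPow M q).trace) : kiefer q N ≤ kiefer q M := by
  by_cases hN' : q ≤ 0 → N.PosDef
  · rw [kiefer_le_kiefer_iff hp hM.posSemidef (fun _ => hM) hN hN']
    have := (potential_le hq hM hN hN').1
    rw [mul_sub, trace_sub, matPow_sub_one_mul_self hM] at this
    linarith
  · push Not at hN'
    rw [kiefer_of_not_posDef hN'.1 hN'.2]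
    exact (kiefer_pos hp hM).le

/-- The first-order condition at `M` and the comparison of values squeeze Klein's inequality into
its equality case. -/
theorem eq_of_kiefer_eq (hp : 0 < p) (hq : q < 1) (hM : M.PosDef) (hN : N.PosDef)
    (h : (matPow M (q - 1) * N).trace ≤ (matPow M q).trace) (hMN : kiefer q M ≤ kiefer q N) :
    M = N := by
  rw [kiefer_le_kiefer_iff hp hN.posSemidef (fun _ => hN) hM.posSemidef (fun _ => hM)] at hMN
  obtain ⟨h1, h2⟩ := potential_le hq hM hN.posSemidef fun _ => hN
  refine h2 (le_antisymm h1 ?_)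
  rw [mul_sub, trace_sub, matPow_sub_one_mul_self hM]
  linarith

end Optimization

end OptDesign

/-! ### Riesz functionals and localizing matrices -/

namespace OptDesign
open Matrix

section Riesz

variable {n k e : ℕ}

/-- The polynomial with a given vector of coefficients. -/
noncomputable def toPoly (u : MultiIdx n e → ℝ) : MvPolynomial (Fin n) ℝ :=
  ∑ α : MultiIdx n e, monomial α.1 (u α)

theorem coeff_toPoly (u : MultiIdx n e → ℝ) (α : MultiIdx n e) : coeff α.1 (toPoly u) = u α := by
  simp only [toPoly, coeff_sum, coeff_monomial]
  rw [Finset.sum_eq_single α] <;> simp +contextual [Subtype.ext_iff]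

theorem totalDegree_monomial_multiIdx_le (α : MultiIdx n e) (c : ℝ) :
    (monomial α.1 c).totalDegree ≤ e := by
  refine (totalDegree_monomial_le _ _).trans ?_
  exact α.2

theorem totalDegree_toPoly_le (u : MultiIdx n e → ℝ) : (toPoly u).totalDegree ≤ e :=
  totalDegree_finsetSum_le fun α _ => totalDegree_monomial_multiIdx_le α _

theorem degree_le_totalDegree {f : MvPolynomial (Fin n) ℝ} {α : Fin n →₀ ℕ} (h : coeff α f ≠ 0) :
    α.degree ≤ f.totalDegree := by
  exact le_totalDegree (mem_support_iff.2 h)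

theorem toPoly_coeff {f : MvPolynomial (Fin n) ℝ} (hf : f.totalDegree ≤ e) :
    toPoly (fun α : MultiIdx n e => coeff α.1 f) = f := by
  ext α
  by_cases h : α.degree ≤ e
  · exact coeff_toPoly _ ⟨α, h⟩
  · have h1 : coeff α f = 0 := by
      by_contra hc
      exact h ((degree_le_totalDegree hc).trans hf)
    have h2 : coeff α (toPoly fun α : MultiIdx n e => coeff α.1 f) = 0 := by
      by_contra hc
      exact h ((degree_le_totalDegree hc).trans (totalDegree_toPoly_le _))
    rw [h1, h2]

/-- The Riesz functional of a truncated sequence as a linear map. -/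
noncomputable def rieszHom (y : MultiIdx n k → ℝ) : MvPolynomial (Fin n) ℝ →ₗ[ℝ] ℝ where
  toFun := riesz y
  map_add' f g := by simp [riesz, add_mul, Finset.sum_add_distrib]
  map_smul' c f := by simp [riesz, Finset.mul_sum, mul_assoc]

theorem rieszHom_apply (y : MultiIdx n k → ℝ) (f) : rieszHom y f = riesz y f := rfl

theorem riesz_add (y : MultiIdx n k → ℝ) (f g) : riesz y (f + g) = riesz y f + riesz y g :=
  map_add (rieszHom y) f g

theorem riesz_sub (y : MultiIdx n k → ℝ) (f g) : riesz y (f - g) = riesz y f - riesz y g :=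
  map_sub (rieszHom y) f g

theorem riesz_sum (y : MultiIdx n k → ℝ) {ι : Type*} (s : Finset ι) (f : ι → MvPolynomial (Fin n) ℝ) :
    riesz y (∑ i ∈ s, f i) = ∑ i ∈ s, riesz y (f i) :=
  map_sum (rieszHom y) f s

theorem riesz_C_mul (y : MultiIdx n k → ℝ) (c : ℝ) (f) : riesz y (C c * f) = c * riesz y f := by
  rw [← smul_eq_C_mul]; exact map_smul (rieszHom y) c f

theorem riesz_monomial (y : MultiIdx n k → ℝ) (α : MultiIdx n k) (c : ℝ) :
    riesz y (monomial α.1 c) = c * y α := by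
  simp only [riesz, coeff_monomial]
  rw [Finset.sum_eq_single α] <;> simp +contextual [Subtype.ext_iff, eq_comm]

theorem riesz_C (y : MultiIdx n k → ℝ) (c : ℝ) : riesz y (C c) = c * y ⟨0, by simp⟩ :=
  riesz_monomial y ⟨0, by simp⟩ c

theorem riesz_toPoly (y u : MultiIdx n k → ℝ) : riesz y (toPoly u) = ∑ α, u α * y α := by
  simp [riesz, coeff_toPoly]

theorem riesz_smul_add (a b : ℝ) (y z : MultiIdx n k → ℝ) (f) :
    riesz (a • y + b • z) f = a * riesz y f + b * riesz z f := by
  simp only [riesz, Pi.add_apply, Pi.smul_apply, smul_eq_mul, Finset.mul_sum,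
    ← Finset.sum_add_distrib]
  exact Finset.sum_congr rfl fun α _ => by ring

theorem continuous_riesz (f : MvPolynomial (Fin n) ℝ) :
    Continuous fun y : MultiIdx n k → ℝ => riesz y f := by
  unfold riesz; fun_prop

theorem dotProduct_localizingMatrix (f : MvPolynomial (Fin n) ℝ) (y : MultiIdx n k → ℝ)
    (u v : MultiIdx n e → ℝ) :
    u ⬝ᵥ (localizingMatrix e f y *ᵥ v) = riesz y (f * toPoly u * toPoly v) := by
  have h : f * toPoly u * toPoly v = ∑ α : MultiIdx n e, ∑ β : MultiIdx n e,
      C (u α * v β) * (f * monomial α.1 1 * monomial β.1 1) := by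
    simp only [toPoly, Finset.mul_sum, Finset.sum_mul]
    rw [Finset.sum_comm]
    refine Finset.sum_congr rfl fun α _ => Finset.sum_congr rfl fun β _ => ?_
    rw [← mul_one (u α), ← mul_one (v β), ← C_mul_monomial, ← C_mul_monomial, C_mul]
    simp only [mul_one]
    ring
  rw [h, riesz_sum]
  simp only [riesz_sum, riesz_C_mul, dotProduct, mulVec, Finset.mul_sum, localizingMatrix]
  exact Finset.sum_congr rfl fun α _ => Finset.sum_congr rfl fun β _ => by ring

/-- Vectors are the coefficient vectors of polynomials of degree at most `e`, and the quadratic form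
at `h` is `L_y (f h ^ 2)`. -/
theorem posSemidef_localizingMatrix_iff (f : MvPolynomial (Fin n) ℝ) (y : MultiIdx n k → ℝ) :
    (localizingMatrix e f y).PosSemidef ↔
      ∀ h : MvPolynomial (Fin n) ℝ, h.totalDegree ≤ e → 0 ≤ riesz y (f * h ^ 2) := by
  rw [posSemidef_iff_dotProduct_mulVec]
  constructor
  · rintro ⟨-, h⟩ p hp
    have := h fun α => coeff α.1 p
    rwa [star_trivial, dotProduct_localizingMatrix, toPoly_coeff hp, mul_assoc, ← sq] at this
  · intro h
    refine ⟨?_, fun u => ?_⟩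
    · ext α β
      simp only [conjTranspose_apply, star_trivial, localizingMatrix]
      rw [mul_right_comm]
    · rw [star_trivial, dotProduct_localizingMatrix, mul_assoc, ← sq]
      exact h _ (totalDegree_toPoly_le u)

theorem momentMatrix_eq (y : MultiIdx n (2 * e) → ℝ) :
    momentMatrix y = localizingMatrix e 1 y := by
  ext α β
  have h : α.1.degree + β.1.degree ≤ 2 * e := by have := α.2; have := β.2; omega
  rw [localizingMatrix, one_mul, monomial_mul, one_mul,
    riesz_monomial y ⟨α.1 + β.1, by rw [map_add]; exact h⟩, one_mul]
  rfl

/-- The degree bound matters: `riesz` silently drops coefficients beyond its order. -/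
theorem riesz_lift {l : ℕ} (h : k ≤ l) {y : MultiIdx n k → ℝ} {z : MultiIdx n l → ℝ}
    (hyz : ∀ α, y α = z (α.lift h)) {f : MvPolynomial (Fin n) ℝ} (hf : f.totalDegree ≤ k) :
    riesz y f = riesz z f := by
  rw [← toPoly_coeff hf]
  rw [riesz_toPoly, toPoly, riesz_sum]
  refine Finset.sum_congr rfl fun α _ => ?_
  rw [hyz]
  exact (riesz_monomial z (α.lift h) _).symm

end Riesz

/-! ### Compactness of the relaxed moment set and its interior points -/

section Cone

variable {n m d δ : ℕ} {g : Fin m → MvPolynomial (Fin n) ℝ}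

/-- The sequences of order `2 * N` whose Riesz functional is nonnegative on the truncated quadratic
module of order `N`. -/
def momentCone (g : Fin m → MvPolynomial (Fin n) ℝ) (N : ℕ) : Set (MultiIdx n (2 * N) → ℝ) :=
  {z | (∀ h : MvPolynomial (Fin n) ℝ, h.totalDegree ≤ N → 0 ≤ riesz z (h ^ 2)) ∧
    ∀ j, halfDegree (g j) ≤ N → ∀ h : MvPolynomial (Fin n) ℝ,
      h.totalDegree ≤ N - halfDegree (g j) → 0 ≤ riesz z (g j * h ^ 2)}

theorem mem_sdpCone_iff {y : MultiIdx n (2 * d) → ℝ} :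
    y ∈ sdpCone g d δ ↔ ∃ z ∈ momentCone g (d + δ),
      ∀ α : MultiIdx n (2 * d), y α = z (α.lift (by omega)) := by
  simp only [sdpCone, momentCone, Set.mem_ofPred_eq, momentMatrix_eq,
    posSemidef_localizingMatrix_iff, one_mul]
  exact ⟨fun ⟨z, h1, h2⟩ => ⟨z, h2, h1⟩, fun ⟨z, h2, h1⟩ => ⟨z, h1, h2⟩⟩

theorem isClosed_momentCone (N : ℕ) : IsClosed (momentCone g N) := by
  have : momentCone g N = {z | ∀ h : MvPolynomial (Fin n) ℝ, h.totalDegree ≤ N →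
      0 ≤ riesz z (h ^ 2)} ∩ {z | ∀ j, halfDegree (g j) ≤ N → ∀ h : MvPolynomial (Fin n) ℝ,
      h.totalDegree ≤ N - halfDegree (g j) → 0 ≤ riesz z (g j * h ^ 2)} := rfl
  rw [this]
  simp only [Set.ofPred_forall]
  refine IsClosed.inter ?_ ?_
  · exact isClosed_iInter fun h => isClosed_iInter fun _ =>
      isClosed_le continuous_const (continuous_riesz _)
  · exact isClosed_iInter fun j => isClosed_iInter fun _ => isClosed_iInter fun h =>
      isClosed_iInter fun _ => isClosed_le continuous_const (continuous_riesz _)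

theorem convex_momentCone (N : ℕ) : Convex ℝ (momentCone g N) := by
  intro y hy z hz a b ha hb _
  refine ⟨fun h hh => ?_, fun j hj h hh => ?_⟩
  · rw [riesz_smul_add]
    exact add_nonneg (mul_nonneg ha (hy.1 h hh)) (mul_nonneg hb (hz.1 h hh))
  · rw [riesz_smul_add]
    exact add_nonneg (mul_nonneg ha (hy.2 j hj h hh)) (mul_nonneg hb (hz.2 j hj h hh))

/-- Induction on the degree: each new unit goes to the half of smaller degree. -/
theorem exists_add_of_degree_le {N : ℕ} (γ : Fin n →₀ ℕ) (hγ : γ.degree ≤ 2 * N) :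
    ∃ α β : Fin n →₀ ℕ, α.degree ≤ N ∧ β.degree ≤ N ∧ α + β = γ := by
  induction hk : γ.degree generalizing γ N with
  | zero =>
    refine ⟨0, 0, by simp, by simp, ?_⟩
    rw [Finsupp.degree_eq_zero_iff] at hk
    simp [hk]
  | succ k ih =>
    have hne : γ ≠ 0 := by rintro rfl; simp at hk
    obtain ⟨i, hi⟩ := Finsupp.ne_iff.1 hne
    have hle : Finsupp.single i 1 ≤ γ := by
      rw [Finsupp.single_le_iff]; simpa [Nat.one_le_iff_ne_zero] using hi
    obtain ⟨γ', rfl⟩ := exists_add_of_le hle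
    rw [map_add, Finsupp.degree_single] at hk hγ
    obtain ⟨α, β, hα, hβ, hαβ⟩ := ih (N := N) γ' (by omega) (by omega)
    have hd : α.degree + β.degree = k := by rw [← map_add, hαβ]; omega
    rcases le_total α.degree β.degree with h | h
    · refine ⟨Finsupp.single i 1 + α, β, ?_, hβ, by rw [add_assoc, hαβ]⟩
      rw [map_add, Finsupp.degree_single]; omega
    · refine ⟨α, Finsupp.single i 1 + β, hα, ?_, by rw [← hαβ, add_left_comm]⟩
      rw [map_add, Finsupp.degree_single]; omega

theorem halfDegree_ball_le (R : ℝ) :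
    halfDegree (C (R ^ 2) - ∑ i : Fin n, X i ^ 2 : MvPolynomial (Fin n) ℝ) ≤ 1 := by
  have h : (C (R ^ 2) - ∑ i : Fin n, X i ^ 2 : MvPolynomial (Fin n) ℝ).totalDegree ≤ 2 := by
    refine (totalDegree_sub _ _).trans (max_le (by rw [totalDegree_C]; omega) ?_)
    exact totalDegree_finsetSum_le fun i _ => by simp
  unfold halfDegree; omega

/-- Localizing the ball constraint at `x ^ β` gives `∑ i, L (x_i ^ 2 x ^ (2 β)) ≤ R ^ 2 L (x ^ (2
β))`. All summands are nonnegative, so each further degree costs at most a factor `max 1 (R ^ 2)`.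
-/
theorem monomial_pow_two_degree_le {N : ℕ} {j : Fin m} {R : ℝ}
    (hj : g j = C (R ^ 2) - ∑ i : Fin n, X i ^ 2) {z : MultiIdx n (2 * N) → ℝ}
    (hz : z ∈ momentCone g N) (α : Fin n →₀ ℕ) (hα : α.degree ≤ N) :
    riesz z (monomial α 1 ^ 2) ≤ (max 1 (R ^ 2)) ^ α.degree * z ⟨0, by simp⟩ := by
  induction hk : α.degree generalizing α with
  | zero =>
    rw [Finsupp.degree_eq_zero_iff] at hk
    subst hk
    have : (monomial (0 : Fin n →₀ ℕ) (1 : ℝ)) ^ 2 = C 1 := by simp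
    rw [this, riesz_C]; simp
  | succ k ih =>
    have hne : α ≠ 0 := by rintro rfl; simp at hk
    obtain ⟨i, hi⟩ := Finsupp.ne_iff.1 hne
    have hle : Finsupp.single i 1 ≤ α := by
      rw [Finsupp.single_le_iff]; simpa [Nat.one_le_iff_ne_zero] using hi
    obtain ⟨β, rfl⟩ := exists_add_of_le hle
    rw [map_add, Finsupp.degree_single] at hk hα
    have h1 := ih β (by omega) (by omega)
    have hb : halfDegree (g j) ≤ 1 := by rw [hj]; exact halfDegree_ball_le R
    have hdeg : ∀ (γ : Fin n →₀ ℕ) (l : ℕ), γ.degree ≤ l →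
        (monomial γ (1 : ℝ)).totalDegree ≤ l := fun γ l h =>
      totalDegree_monomial_multiIdx_le ⟨γ, h⟩ 1
    have h2 := hz.2 j (by omega) (monomial β 1) (hdeg _ _ (by omega))
    rw [hj, sub_mul, riesz_sub, riesz_C_mul, Finset.sum_mul, riesz_sum] at h2
    have hXm : ∀ i : Fin n, (X i ^ 2 * monomial β (1 : ℝ) ^ 2 : MvPolynomial (Fin n) ℝ) =
        monomial (Finsupp.single i 1 + β) 1 ^ 2 := by
      intro i
      rw [← mul_pow, X, monomial_mul, one_mul]
    simp only [hXm] at h2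
    have h3 : riesz z (monomial (Finsupp.single i 1 + β) 1 ^ 2) ≤
        ∑ i, riesz z (monomial (Finsupp.single i 1 + β) 1 ^ 2) :=
      Finset.single_le_sum (f := fun i => riesz z (monomial (Finsupp.single i 1 + β) 1 ^ 2))
        (fun l _ => hz.1 _ (hdeg _ _ (by rw [map_add, Finsupp.degree_single]; omega)))
        (Finset.mem_univ i)
    have h4 := hz.1 (monomial β 1) (hdeg _ _ (by omega))
    calc _ ≤ R ^ 2 * riesz z (monomial β 1 ^ 2) := by linarith
      _ ≤ max 1 (R ^ 2) * riesz z (monomial β 1 ^ 2) :=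
        mul_le_mul_of_nonneg_right (le_max_right _ _) h4
      _ ≤ max 1 (R ^ 2) * (max 1 (R ^ 2) ^ k * z ⟨0, by simp⟩) :=
        mul_le_mul_of_nonneg_left h1 (le_max_of_le_left zero_le_one)
      _ = _ := by ring

/-- With `γ = α + β`, nonnegativity of `L ((x ^ α ± x ^ β) ^ 2)` bounds a mixed moment by the mean
of two even ones. -/
theorem abs_le_of_mem_momentCone {N : ℕ} {j : Fin m} {R : ℝ}
    (hj : g j = C (R ^ 2) - ∑ i : Fin n, X i ^ 2) {z : MultiIdx n (2 * N) → ℝ}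
    (hz : z ∈ momentCone g N) (hz0 : z ⟨0, by simp⟩ = 1) (γ : MultiIdx n (2 * N)) :
    |z γ| ≤ max 1 (R ^ 2) ^ N := by
  obtain ⟨α, β, hα, hβ, hαβ⟩ := exists_add_of_degree_le γ.1 γ.2
  have hdeg : ∀ (γ : Fin n →₀ ℕ), γ.degree ≤ N →
      (monomial γ (1 : ℝ)).totalDegree ≤ N := fun γ h => totalDegree_monomial_multiIdx_le ⟨γ, h⟩ 1
  have hmul : riesz z (monomial α 1 * monomial β 1) = z γ := by
    rw [monomial_mul, hαβ, one_mul, riesz_monomial, one_mul]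
  have hB : ∀ γ : Fin n →₀ ℕ, γ.degree ≤ N → riesz z (monomial γ 1 ^ 2) ≤ max 1 (R ^ 2) ^ N := by
    intro γ hγ
    have h := monomial_pow_two_degree_le hj hz γ hγ
    rw [hz0, mul_one] at h
    exact h.trans (pow_le_pow_right₀ (le_max_left _ _) hγ)
  have h1 := hz.1 (monomial α 1 + monomial β 1)
    ((totalDegree_add _ _).trans (max_le (hdeg α hα) (hdeg β hβ)))
  have h2 := hz.1 (monomial α 1 - monomial β 1)
    ((totalDegree_sub _ _).trans (max_le (hdeg α hα) (hdeg β hβ)))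
  have e1 : (monomial α (1 : ℝ) + monomial β 1) ^ 2 =
      monomial α 1 ^ 2 + C 2 * (monomial α 1 * monomial β 1) + monomial β 1 ^ 2 := by
    rw [show (C (2 : ℝ) : MvPolynomial (Fin n) ℝ) = 2 from map_ofNat _ 2]; ring
  have e2 : (monomial α (1 : ℝ) - monomial β 1) ^ 2 =
      monomial α 1 ^ 2 - C 2 * (monomial α 1 * monomial β 1) + monomial β 1 ^ 2 := by
    rw [show (C (2 : ℝ) : MvPolynomial (Fin n) ℝ) = 2 from map_ofNat _ 2]; ring
  rw [e1, riesz_add, riesz_add, riesz_C_mul, hmul] at h1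
  rw [e2, riesz_add, riesz_sub, riesz_C_mul, hmul] at h2
  have := hB α hα
  have := hB β hβ
  rw [abs_le]
  constructor <;> linarith

theorem isCompact_momentCone_normalized {N : ℕ}
    (hball : ∃ (j : Fin m) (R : ℝ), g j = C (R ^ 2) - ∑ i : Fin n, X i ^ 2) :
    IsCompact (momentCone g N ∩ {z | z ⟨0, by simp⟩ = 1}) := by
  obtain ⟨j, R, hj⟩ := hball
  refine Metric.isCompact_of_isClosed_isBounded
    ((isClosed_momentCone N).inter (isClosed_eq (continuous_apply _) continuous_const)) ?_
  refine (Metric.isBounded_closedBall (x := 0) (r := max 1 (R ^ 2) ^ N)).subset fun z hz => ?_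
  rw [mem_closedBall_zero_iff, pi_norm_le_iff_of_nonneg (by positivity)]
  exact fun γ => abs_le_of_mem_momentCone hj hz.1 hz.2 γ

theorem feasibleSet_eq_image : feasibleSet g d δ =
    (fun (z : MultiIdx n (2 * (d + δ)) → ℝ) (α : MultiIdx n (2 * d)) => z (α.lift (by omega))) ''
      (momentCone g (d + δ) ∩ {z | z ⟨0, by simp⟩ = 1}) := by
  ext y
  simp only [feasibleSet, Set.mem_ofPred_eq, mem_sdpCone_iff, Set.mem_image, Set.mem_inter_iff]
  constructor
  · rintro ⟨⟨z, hz, hyz⟩, hy⟩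
    refine ⟨z, ⟨hz, ?_⟩, funext fun α => (hyz α).symm⟩
    rw [hyz] at hy
    exact hy
  · rintro ⟨z, ⟨hz, hz0⟩, rfl⟩
    exact ⟨⟨z, hz, fun _ => rfl⟩, hz0⟩

theorem isCompact_feasibleSet
    (hball : ∃ (j : Fin m) (R : ℝ), g j = C (R ^ 2) - ∑ i : Fin n, X i ^ 2) :
    IsCompact (feasibleSet g d δ) := by
  rw [feasibleSet_eq_image]
  exact (isCompact_momentCone_normalized hball).image (by fun_prop)

theorem convex_feasibleSet : Convex ℝ (feasibleSet g d δ) := by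
  intro y hy z hz a b ha hb hab
  rw [feasibleSet, Set.mem_ofPred_eq, mem_sdpCone_iff] at *
  obtain ⟨⟨y', hy', hyy⟩, hy0⟩ := hy
  obtain ⟨⟨z', hz', hzz⟩, hz0⟩ := hz
  refine ⟨⟨a • y' + b • z', convex_momentCone _ hy' hz' ha hb hab, fun α => ?_⟩, ?_⟩
  · simp [hyy, hzz]
  · simp [hy0, hz0, hab]

/-- The truncated moment sequence of a finite average of Dirac measures. -/
noncomputable def averageMoments (k : ℕ) (S : Finset (Fin n → ℝ)) (α : MultiIdx n k) : ℝ :=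
  (S.card : ℝ)⁻¹ * ∑ x ∈ S, eval x (monomial α.1 1)

theorem riesz_averageMoments {k : ℕ} (S : Finset (Fin n → ℝ)) {f : MvPolynomial (Fin n) ℝ}
    (hf : f.totalDegree ≤ k) :
    riesz (averageMoments k S) f = (S.card : ℝ)⁻¹ * ∑ x ∈ S, eval x f := by
  rw [← toPoly_coeff hf, riesz_toPoly]
  simp only [averageMoments, toPoly, map_sum]
  rw [Finset.sum_comm, Finset.mul_sum]
  refine Finset.sum_congr rfl fun α _ => ?_
  rw [mul_left_comm, Finset.mul_sum]
  refine congrArg _ (Finset.sum_congr rfl fun x _ => ?_)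
  simp [eval_monomial]

theorem averageMoments_mem_feasibleSet {S : Finset (Fin n → ℝ)} (hS : S.Nonempty)
    (hSX : ∀ x ∈ S, x ∈ designSpace g) : averageMoments (2 * d) S ∈ feasibleSet g d δ := by
  have hc : (0 : ℝ) ≤ (S.card : ℝ)⁻¹ := by positivity
  rw [feasibleSet, Set.mem_ofPred_eq, mem_sdpCone_iff]
  refine ⟨⟨averageMoments (2 * (d + δ)) S, ⟨fun h hh => ?_, fun j hj h hh => ?_⟩, fun α => rfl⟩, ?_⟩
  · rw [riesz_averageMoments S ((totalDegree_pow _ _).trans (by omega))]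
    exact mul_nonneg hc (Finset.sum_nonneg fun x _ => by rw [map_pow]; exact sq_nonneg _)
  · have h1 := totalDegree_mul (g j) (h ^ 2)
    have h2 := totalDegree_pow h 2
    rw [riesz_averageMoments S (by unfold halfDegree at hj hh; omega)]
    refine mul_nonneg hc (Finset.sum_nonneg fun x hx => ?_)
    rw [map_mul, map_pow]
    exact mul_nonneg (hSX x hx j) (sq_nonneg _)
  · have : (S.card : ℝ) ≠ 0 := by exact_mod_cast hS.card_pos.ne'
    simp [averageMoments, this]

/-- Balls of the supremum norm are boxes, the shape in which polynomial identities can be tested one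
coordinate at a time. -/
theorem exists_box_subset_designSpace (hint : (interior (designSpace g)).Nonempty) :
    ∃ s : Fin n → Set ℝ, (∀ i, (s i).Infinite) ∧ Set.pi Set.univ s ⊆ designSpace g := by
  obtain ⟨x, hx⟩ := hint
  obtain ⟨ε, hε, h⟩ := Metric.isOpen_iff.1 isOpen_interior x hx
  refine ⟨fun i => Set.Ioo (x i - ε) (x i + ε), fun i => Set.Ioo_infinite (by linarith), ?_⟩
  intro y hy
  refine interior_subset (h ?_)
  rw [mem_ball_iff_norm, pi_norm_lt_iff hε]
  intro i
  have := hy i trivial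
  rw [Pi.sub_apply, Real.norm_eq_abs, abs_lt]
  constructor <;> linarith [this.1, this.2]

/-- A grid with `D + 1` points in each coordinate determines polynomials of degree at most `D`. -/
theorem exists_finset_designSpace (hint : (interior (designSpace g)).Nonempty) (D : ℕ) :
    ∃ S : Finset (Fin n → ℝ), S.Nonempty ∧ (∀ x ∈ S, x ∈ designSpace g) ∧
      ∀ f : MvPolynomial (Fin n) ℝ, f.totalDegree ≤ D → (∀ x ∈ S, eval x f = 0) → f = 0 := by
  obtain ⟨s, hs, hsX⟩ := exists_box_subset_designSpace hint
  choose t ht hcard using fun i => (hs i).exists_subset_card_eq (D + 1)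
  refine ⟨Fintype.piFinset t, ?_, fun x hx => hsX fun i _ => ?_, fun f hf h => ?_⟩
  · rw [Fintype.piFinset_nonempty]
    exact fun i => Finset.card_pos.1 (by rw [hcard]; omega)
  · exact ht i (Fintype.mem_piFinset.1 hx i)
  · refine eq_zero_of_eval_zero_at_prod_finset f t (fun i => ?_) fun x hx =>
      h x (Fintype.mem_piFinset.2 hx)
    have := degreeOf_le_totalDegree f i
    rw [hcard]; omega

end Cone

end OptDesign

/-! ### Information matrices and the dual polynomial -/

namespace OptDesign
open Matrix

section Information

variable {n m d δ p : ℕ} {q : ℝ} {g : Fin m → MvPolynomial (Fin n) ℝ}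
  {A : Matrix (Fin p) (MultiIdx n d) ℝ}

theorem infoMatrix_apply (A : Matrix (Fin p) (MultiIdx n d) ℝ) (y : MultiIdx n (2 * d) → ℝ)
    (i j : Fin p) : infoMatrix A y i j = riesz y (regressor A i * regressor A j) := by
  have h : infoMatrix A y i j = A i ⬝ᵥ (momentMatrix y *ᵥ A j) := by
    rw [infoMatrix, Matrix.mul_assoc]
    rfl
  rw [h, momentMatrix_eq, dotProduct_localizingMatrix, one_mul]
  rfl

theorem trace_matPow_mul_infoMatrix (r : ℝ) (M : Matrix (Fin p) (Fin p) ℝ)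
    (z : MultiIdx n (2 * d) → ℝ) : (matPow M r * infoMatrix A z).trace =
      riesz z (∑ i, ∑ j, regressor A i * C (matPow M r i j) * regressor A j) := by
  simp only [riesz_sum, trace, diag_apply, mul_apply, infoMatrix_apply]
  refine Finset.sum_congr rfl fun i _ => Finset.sum_congr rfl fun j _ => ?_
  rw [mul_comm (regressor A i) (C _), mul_assoc, riesz_C_mul, mul_comm (regressor A i)]

/-- This translates the first-order condition into positivity of `L_z` on the dual polynomial; the
normalization of `z` accounts for the constant term. -/
theorem riesz_dualPoly (y : MultiIdx n (2 * d) → ℝ) {z : MultiIdx n (2 * d) → ℝ}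
    (hz : z ⟨0, by simp⟩ = 1) : riesz z (dualPoly q A y) =
      (matPow (infoMatrix A y) q).trace -
        (matPow (infoMatrix A y) (q - 1) * infoMatrix A z).trace := by
  rw [dualPoly, riesz_sub, riesz_C, hz, mul_one, christoffel, trace_matPow_mul_infoMatrix]

theorem totalDegree_dualPoly_le (y : MultiIdx n (2 * d) → ℝ) :
    (dualPoly q A y).totalDegree ≤ 2 * d := by
  refine (totalDegree_sub _ _).trans (max_le (by rw [totalDegree_C]; omega) ?_)
  refine totalDegree_finsetSum_le fun i _ => totalDegree_finsetSum_le fun j _ => ?_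
  have h1 := totalDegree_mul (regressor A i * C (matPow (infoMatrix A y) (q - 1) i j))
    (regressor A j)
  have h2 := totalDegree_mul (regressor A i) (C (matPow (infoMatrix A y) (q - 1) i j))
  have h3 : (regressor A i).totalDegree ≤ d := totalDegree_toPoly_le (A i)
  have h4 : (regressor A j).totalDegree ≤ d := totalDegree_toPoly_le (A j)
  rw [totalDegree_C] at h2
  omega

theorem continuous_infoMatrix (A : Matrix (Fin p) (MultiIdx n d) ℝ) :
    Continuous (infoMatrix A) := by
  refine continuous_matrix fun i j => ?_
  simp only [infoMatrix_apply]
  exact continuous_riesz _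

theorem infoMatrix_smul_add (a b : ℝ) (y z : MultiIdx n (2 * d) → ℝ) :
    infoMatrix A (a • y + b • z) = a • infoMatrix A y + b • infoMatrix A z := by
  ext i j
  simp [infoMatrix_apply, riesz_smul_add]

theorem posSemidef_momentMatrix {y : MultiIdx n (2 * d) → ℝ} (hy : y ∈ sdpCone g d δ) :
    (momentMatrix y).PosSemidef := by
  rw [momentMatrix_eq, posSemidef_localizingMatrix_iff]
  intro h hh
  obtain ⟨z, hz, hyz⟩ := mem_sdpCone_iff.1 hy
  have h1 := totalDegree_pow h 2
  rw [one_mul, riesz_lift (by omega) hyz (by omega)]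
  exact hz.1 h (by omega)

theorem posSemidef_infoMatrix {y : MultiIdx n (2 * d) → ℝ} (hy : y ∈ sdpCone g d δ) :
    (infoMatrix A y).PosSemidef := by
  have := (posSemidef_momentMatrix hy).mul_mul_conjTranspose_same A
  rwa [conjTranspose_eq_transpose_of_trivial] at this

/-- The average of Dirac measures over a grid determining degree `d` has positive definite moment
matrix, and independence of the rows of `A` preserves definiteness. -/
theorem exists_mem_feasibleSet_posDef (hint : (interior (designSpace g)).Nonempty)
    (hA : A.rank = p) : ∃ y ∈ feasibleSet g d δ, (infoMatrix A y).PosDef := by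
  obtain ⟨S, hS, hSX, hS0⟩ := exists_finset_designSpace hint d
  refine ⟨averageMoments (2 * d) S, averageMoments_mem_feasibleSet hS hSX, ?_⟩
  have hmom : (momentMatrix (averageMoments (2 * d) S)).PosDef := by
    refine PosDef.of_dotProduct_mulVec_pos (posSemidef_momentMatrix
      (averageMoments_mem_feasibleSet (δ := 0) hS hSX).1).1 fun {u} hu => ?_
    have hdeg := totalDegree_toPoly_le u
    have h2 := totalDegree_pow (toPoly u) 2
    rw [star_trivial, momentMatrix_eq, dotProduct_localizingMatrix, one_mul, ← sq,
      riesz_averageMoments S (by omega)]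
    have hc : (0 : ℝ) < (S.card : ℝ)⁻¹ := by
      have := hS.card_pos
      positivity
    refine mul_pos hc (lt_of_le_of_ne
      (Finset.sum_nonneg fun x _ => by rw [map_pow]; exact sq_nonneg _) fun h0 => hu ?_)
    rw [eq_comm, Finset.sum_eq_zero_iff_of_nonneg
      (fun x _ => by rw [map_pow]; exact sq_nonneg _)] at h0
    have := hS0 _ hdeg fun x hx => by simpa using h0 x hx
    ext α
    rw [← coeff_toPoly u α, this]; simp
  have hinj : Function.Injective A.vecMul := by
    rw [vecMul_injective_iff, linearIndependent_iff_card_eq_finrank_span,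
      Set.finrank, ← rank_eq_finrank_span_row, hA, Fintype.card_fin]
  have := hmom.mul_mul_conjTranspose_same hinj
  rwa [conjTranspose_eq_transpose_of_trivial] at this

end Information

/-! ### Closed cones, separation and Gram matrices -/

section Duality

/-- Compactness of the unit slice of `P` yields `c ‖x‖ ≤ ‖T x‖` on `P`, so preimages of a convergent
sequence stay in a compact set. -/
theorem isClosed_image_of_ker_eq_zero {E F : Type*} [NormedAddCommGroup E] [NormedSpace ℝ E]
    [FiniteDimensional ℝ E] [NormedAddCommGroup F] [NormedSpace ℝ F] (T : E →L[ℝ] F) {P : Set E}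
    (hP : IsClosed P) (hsmul : ∀ c : ℝ, 0 ≤ c → ∀ x ∈ P, c • x ∈ P)
    (hker : ∀ x ∈ P, T x = 0 → x = 0) : IsClosed (T '' P) := by
  have : ProperSpace E := FiniteDimensional.proper_real E
  obtain ⟨c, hc, hcT⟩ : ∃ c > 0, ∀ x ∈ P, c * ‖x‖ ≤ ‖T x‖ := by
    have hcomp : IsCompact (P ∩ Metric.sphere 0 1) := (isCompact_sphere 0 1).inter_left hP
    rcases (P ∩ Metric.sphere (0 : E) 1).eq_empty_or_nonempty with h | h
    · refine ⟨1, one_pos, fun x hx => ?_⟩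
      by_cases hx0 : x = 0
      · simp [hx0]
      · have hn : ‖x‖ ≠ 0 := norm_ne_zero_iff.2 hx0
        have : ‖x‖⁻¹ • x ∈ P ∩ Metric.sphere (0 : E) 1 :=
          ⟨hsmul _ (by positivity) x hx, by simp [norm_smul, hn]⟩
        simp [h] at this
    · obtain ⟨x₀, hx₀, hmin⟩ := hcomp.exists_isMinOn h T.continuous.norm.continuousOn
      refine ⟨‖T x₀‖, norm_pos_iff.2 fun h0 => ?_, fun x hx => ?_⟩
      · have h1 := hx₀.2
        rw [hker x₀ hx₀.1 h0] at h1
        simp at h1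
      · by_cases hx0 : x = 0
        · simp [hx0]
        · have hn : ‖x‖ ≠ 0 := norm_ne_zero_iff.2 hx0
          have : ‖x‖⁻¹ • x ∈ P ∩ Metric.sphere (0 : E) 1 :=
            ⟨hsmul _ (by positivity) x hx, by simp [norm_smul, hn]⟩
          have h2 : ‖T x₀‖ ≤ ‖T (‖x‖⁻¹ • x)‖ := hmin this
          rw [map_smul, norm_smul, norm_inv, norm_norm] at h2
          calc _ ≤ ‖x‖⁻¹ * ‖T x‖ * ‖x‖ := mul_le_mul_of_nonneg_right h2 (norm_nonneg _)
            _ = _ := by field_simp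
  refine IsSeqClosed.isClosed fun u y hu huy => ?_
  choose x hxP hxu using hu
  obtain ⟨B, hB⟩ := huy.norm.bddAbove_range
  have hcomp : IsCompact (P ∩ Metric.closedBall 0 (B / c)) :=
    (isCompact_closedBall 0 (B / c)).inter_left hP
  have hmem : y ∈ T '' (P ∩ Metric.closedBall 0 (B / c)) := by
    refine (hcomp.image T.continuous).isClosed.mem_of_tendsto huy (.of_forall fun k => ?_)
    refine ⟨x k, ⟨hxP k, ?_⟩, hxu k⟩
    rw [mem_closedBall_zero_iff, le_div_iff₀ hc, mul_comm]
    refine (hcT _ (hxP k)).trans ?_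
    rw [hxu]
    exact hB ⟨k, rfl⟩
  exact Set.image_mono Set.inter_subset_left hmem

theorem exists_separating_of_cone {ι : Type*} [Finite ι] {I : Set (ι → ℝ)} (hI : IsClosed I)
    (hconv : Convex ℝ I) (h0 : 0 ∈ I) (hsmul : ∀ c : ℝ, 0 ≤ c → ∀ x ∈ I, c • x ∈ I) {b : ι → ℝ}
    (hb : b ∉ I) : ∃ φ : (ι → ℝ) →ₗ[ℝ] ℝ, (∀ x ∈ I, 0 ≤ φ x) ∧ φ b < 0 := by
  have := Fintype.ofFinite ι
  obtain ⟨φ, u, hφ, hu⟩ := geometric_hahn_banach_closed_point hconv hI hb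
  have hu0 : 0 < u := by simpa using hφ 0 h0
  refine ⟨-(φ : (ι → ℝ) →ₗ[ℝ] ℝ), fun x hx => ?_, ?_⟩
  · rw [LinearMap.neg_apply, neg_nonneg]
    by_contra! hpos
    have hpos' : 0 < φ x := hpos
    -- On a cone a functional bounded above is nonpositive: this scaling would make it attain the
    -- strict bound `u`.
    have := hφ _ (hsmul (u / φ x) (by positivity) x hx)
    rw [map_smul, smul_eq_mul, div_mul_cancel₀ _ hpos'.ne'] at this
    exact lt_irrefl _ this
  · rw [LinearMap.neg_apply, neg_lt_zero]
    exact hu0.trans hu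

variable {n m d δ e N : ℕ} {g : Fin m → MvPolynomial (Fin n) ℝ}

/-- The polynomial with a given Gram matrix. -/
noncomputable def gramPoly (G : Matrix (MultiIdx n e) (MultiIdx n e) ℝ) :
    MvPolynomial (Fin n) ℝ :=
  ∑ α, ∑ β, C (G α β) * (monomial α.1 1 * monomial β.1 1)

theorem gramPoly_smul_add (a b : ℝ) (G H : Matrix (MultiIdx n e) (MultiIdx n e) ℝ) :
    gramPoly (a • G + b • H) = C a * gramPoly G + C b * gramPoly H := by
  simp only [gramPoly, Finset.mul_sum, ← Finset.sum_add_distrib]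
  refine Finset.sum_congr rfl fun α _ => Finset.sum_congr rfl fun β _ => ?_
  simp only [Matrix.add_apply, Matrix.smul_apply, smul_eq_mul, C_add, C_mul]
  ring

theorem gramPoly_zero : gramPoly (0 : Matrix (MultiIdx n e) (MultiIdx n e) ℝ) = 0 := by
  simp [gramPoly]

theorem toPoly_eq (u : MultiIdx n e → ℝ) : toPoly u = ∑ α, C (u α) * monomial α.1 1 := by
  simp [toPoly, C_mul_monomial]

theorem gramPoly_transpose_mul_self {κ : Type*} [Fintype κ] (B : Matrix κ (MultiIdx n e) ℝ) :
    gramPoly (Bᵀ * B) = ∑ k, toPoly (B k) ^ 2 := by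
  simp only [gramPoly, toPoly_eq, sq, Finset.sum_mul, Finset.mul_sum, mul_apply, transpose_apply,
    map_sum, C_mul]
  have h1 : ∀ α : MultiIdx n e, ∑ β : MultiIdx n e, ∑ k, C (B k α) * C (B k β) *
      (monomial α.1 (1 : ℝ) * monomial β.1 1) = ∑ k, ∑ β : MultiIdx n e, C (B k α) * C (B k β) *
      (monomial α.1 (1 : ℝ) * monomial β.1 1) := fun α => Finset.sum_comm
  rw [Finset.sum_congr rfl fun α _ => h1 α, Finset.sum_comm]
  refine Finset.sum_congr rfl fun k _ => ?_
  rw [Finset.sum_comm]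
  refine Finset.sum_congr rfl fun α _ => Finset.sum_congr rfl fun β _ => ?_
  ring

open scoped MatrixOrder in
theorem exists_gramPoly_eq_sum_sq {G : Matrix (MultiIdx n e) (MultiIdx n e) ℝ}
    (hG : G.PosSemidef) : ∃ B : Matrix (MultiIdx n e) (MultiIdx n e) ℝ, G = Bᵀ * B ∧
      gramPoly G = ∑ k, toPoly (B k) ^ 2 := by
  classical
  obtain ⟨B, hB⟩ := CStarAlgebra.nonneg_iff_eq_star_mul_self.1 hG.nonneg
  have hB' : G = Bᵀ * B := by
    rw [hB, star_eq_conjTranspose, conjTranspose_eq_transpose_of_trivial]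
  exact ⟨B, hB', by rw [hB', gramPoly_transpose_mul_self]⟩

theorem gramPoly_mem_sosCone {G : Matrix (MultiIdx n e) (MultiIdx n e) ℝ} (hG : G.PosSemidef) :
    gramPoly G ∈ sosCone n e := by
  obtain ⟨B, -, hB⟩ := exists_gramPoly_eq_sum_sq hG
  let ι := Fintype.equivFin (MultiIdx n e)
  refine ⟨Fintype.card (MultiIdx n e), fun i => toPoly (B (ι.symm i)),
    fun i => totalDegree_toPoly_le _, ?_⟩
  rw [hB]
  exact (Equiv.sum_comp ι.symm fun k => toPoly (B k) ^ 2).symm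

theorem gramPoly_vecMulVec (u : MultiIdx n e → ℝ) : gramPoly (vecMulVec u u) = toPoly u ^ 2 := by
  simp only [gramPoly, toPoly_eq, sq, Finset.sum_mul, Finset.mul_sum, vecMulVec_apply, C_mul]
  rw [Finset.sum_comm]
  refine Finset.sum_congr rfl fun α _ => Finset.sum_congr rfl fun β _ => ?_
  ring

theorem totalDegree_gramPoly_le (G : Matrix (MultiIdx n e) (MultiIdx n e) ℝ) :
    (gramPoly G).totalDegree ≤ 2 * e := by
  refine totalDegree_finsetSum_le fun α _ => totalDegree_finsetSum_le fun β _ => ?_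
  have h1 := totalDegree_mul (C (G α β)) (monomial α.1 1 * monomial β.1 1)
  have h2 := totalDegree_mul (monomial α.1 (1 : ℝ)) (monomial β.1 1)
  have h3 := totalDegree_monomial_multiIdx_le α 1
  have h4 := totalDegree_monomial_multiIdx_le β 1
  rw [totalDegree_C] at h1
  omega

end Duality

end OptDesign

/-! ### Duality between the truncated quadratic module and the moment cone -/

namespace OptDesign
open Matrix

section Duality

variable {n m d δ N : ℕ} {g : Fin m → MvPolynomial (Fin n) ℝ}

/-- The describing polynomials together with the constant `1`. -/
noncomputable def describing (g : Fin m → MvPolynomial (Fin n) ℝ) (o : Option (Fin m)) :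
    MvPolynomial (Fin n) ℝ := o.elim 1 g

theorem halfDegree_describing_none : halfDegree (describing g none) = 0 := by
  simp [describing, halfDegree]

/-- Families of symmetric matrices of the sizes of the Gram matrices in a truncated quadratic
module. -/
abbrev GramFamily (g : Fin m → MvPolynomial (Fin n) ℝ) (N : ℕ) : Type :=
  ∀ o : Option (Fin m), Matrix (MultiIdx n (N - halfDegree (describing g o)))
    (MultiIdx n (N - halfDegree (describing g o))) ℝ

/-- The element of the truncated quadratic module given by a family of Gram matrices. -/
noncomputable def gramSum (G : GramFamily g N) : MvPolynomial (Fin n) ℝ :=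
  ∑ o, describing g o * gramPoly (G o)

/-- The families of positive semidefinite Gram matrices, with trivial entries where the multiplier
vanishes or its degree is too high. -/
def gramCone (g : Fin m → MvPolynomial (Fin n) ℝ) (N : ℕ) : Set (GramFamily g N) :=
  {G | ∀ o, (G o).PosSemidef ∧
    ((describing g o = 0 ∨ N < halfDegree (describing g o)) → G o = 0)}

theorem gramSum_smul_add (a b : ℝ) (G H : GramFamily g N) :
    gramSum (a • G + b • H) = C a * gramSum G + C b * gramSum H := by
  simp only [gramSum, Finset.mul_sum, ← Finset.sum_add_distrib]
  refine Finset.sum_congr rfl fun o _ => ?_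
  rw [Pi.add_apply, Pi.smul_apply, Pi.smul_apply, gramPoly_smul_add]
  ring

/-- The coefficients of degree at most `2 * N` of `gramSum`. -/
noncomputable def gramCoeff (g : Fin m → MvPolynomial (Fin n) ℝ) (N : ℕ) :
    GramFamily g N →ₗ[ℝ] (MultiIdx n (2 * N) → ℝ) where
  toFun G α := coeff α.1 (gramSum G)
  map_add' G H := by
    ext α
    have := gramSum_smul_add 1 1 G H
    rw [one_smul, one_smul, C_1, one_mul, one_mul] at this
    rw [this, coeff_add]; rfl
  map_smul' c G := by
    ext α
    have := gramSum_smul_add c 0 G 0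
    rw [zero_smul, add_zero, C_0, zero_mul, add_zero] at this
    rw [this, coeff_C_mul]; rfl

theorem gramCone_smul_add {a b : ℝ} (ha : 0 ≤ a) (hb : 0 ≤ b) {G H : GramFamily g N}
    (hG : G ∈ gramCone g N) (hH : H ∈ gramCone g N) : a • G + b • H ∈ gramCone g N := by
  refine fun o => ⟨((hG o).1.smul ha).add ((hH o).1.smul hb), fun h => ?_⟩
  rw [Pi.add_apply, Pi.smul_apply, Pi.smul_apply, (hG o).2 h, (hH o).2 h, smul_zero, smul_zero,
    add_zero]

theorem zero_mem_gramCone : (0 : GramFamily g N) ∈ gramCone g N :=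
  fun _ => ⟨PosSemidef.zero, fun _ => rfl⟩

theorem gramCone_smul {a : ℝ} (ha : 0 ≤ a) {G : GramFamily g N} (hG : G ∈ gramCone g N) :
    a • G ∈ gramCone g N := by
  have := gramCone_smul_add ha le_rfl hG hG
  rwa [zero_smul, add_zero] at this

theorem isClosed_gramCone : IsClosed (gramCone g N) := by
  have : gramCone g N = ⋂ o, (fun G : GramFamily g N => G o) ⁻¹'
      ({M | M.PosSemidef} ∩
        {M | (describing g o = 0 ∨ N < halfDegree (describing g o)) → M = 0}) := by
    ext G
    simp only [gramCone, Set.mem_iInter]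
    rfl
  rw [this]
  refine isClosed_iInter fun o => IsClosed.preimage (continuous_apply o)
    (isClosed_setOf_posSemidef.inter ?_)
  by_cases h : describing g o = 0 ∨ N < halfDegree (describing g o)
  · simp only [h, true_imp_iff]
    exact isClosed_eq continuous_id continuous_const
  · simp only [h, false_imp_iff]
    exact isClosed_univ

theorem totalDegree_gramSum_le {G : GramFamily g N} (hG : G ∈ gramCone g N) :
    (gramSum G).totalDegree ≤ 2 * N := by
  refine totalDegree_finsetSum_le fun o _ => ?_
  -- Natural subtraction leaves a `1 × 1` block when the degree is too high; the cone condition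
  -- forces it to vanish.
  by_cases h : N < halfDegree (describing g o)
  · rw [(hG o).2 (Or.inr h), gramPoly_zero, mul_zero, totalDegree_zero]; omega
  · have h1 := totalDegree_mul (describing g o) (gramPoly (G o))
    have h2 := totalDegree_gramPoly_le (G o)
    have h3 : halfDegree (describing g o) = ((describing g o).totalDegree + 1) / 2 := rfl
    omega

theorem toPoly_gramCoeff {G : GramFamily g N} (hG : G ∈ gramCone g N) :
    toPoly (gramCoeff g N G) = gramSum G := toPoly_coeff (totalDegree_gramSum_le hG)

/-- On a box inside the design space all summands are nonnegative, so each vanishes there and hence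
identically. Either the describing polynomial is zero, where `gramCone` forces a zero block, or
every square in the Gram factorization vanishes. -/
theorem eq_zero_of_gramSum_eq_zero (hint : (interior (designSpace g)).Nonempty)
    {G : GramFamily g N} (hG : G ∈ gramCone g N) (h : gramSum G = 0) : G = 0 := by
  obtain ⟨s, hs, hsX⟩ := exists_box_subset_designSpace hint
  choose B hGB hB using fun o => exists_gramPoly_eq_sum_sq (hG o).1
  have hpos : ∀ x ∈ Set.pi Set.univ s, ∀ o, 0 ≤ eval x (describing g o) := by
    intro x hx o
    cases o with
    | none => simp [describing]
    | some j => exact hsX hx j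
  have hsq : ∀ x o, 0 ≤ eval x (gramPoly (G o)) := by
    intro x o
    rw [hB, map_sum]
    exact Finset.sum_nonneg fun k _ => by rw [map_pow]; exact sq_nonneg _
  have hz : ∀ o, describing g o * gramPoly (G o) = 0 := by
    intro o
    refine funext_set s hs fun x hx => ?_
    have h0 : eval x (gramSum G) = 0 := by rw [h, map_zero]
    rw [gramSum, map_sum, Finset.sum_eq_zero_iff_of_nonneg fun o _ => by
      rw [map_mul]; exact mul_nonneg (hpos x hx o) (hsq x o)] at h0
    rw [h0 o (Finset.mem_univ o), map_zero]
  funext o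
  rcases mul_eq_zero.1 (hz o) with h0 | h0
  · exact (hG o).2 (Or.inl h0)
  · have hB0 : B o = 0 := by
      ext k α
      rw [← coeff_toPoly (B o k) α]
      have : toPoly (B o k) = 0 := by
        refine MvPolynomial.funext fun x => ?_
        have h1 : eval x (gramPoly (G o)) = 0 := by rw [h0, map_zero]
        rw [hB, map_sum, Finset.sum_eq_zero_iff_of_nonneg fun k _ => by
          rw [map_pow]; exact sq_nonneg _] at h1
        have := h1 k (Finset.mem_univ k)
        rw [map_pow, pow_eq_zero_iff two_ne_zero] at this
        rw [this, map_zero]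
      rw [this]; simp
    rw [hGB o, hB0, Matrix.mul_zero]; rfl

open scoped Matrix.Norms.Elementwise in
theorem isClosed_gramCoeff_image (hint : (interior (designSpace g)).Nonempty) :
    IsClosed (gramCoeff g N '' gramCone g N) := by
  refine isClosed_image_of_ker_eq_zero (LinearMap.toContinuousLinearMap (gramCoeff g N))
    isClosed_gramCone (fun c hc G hG => gramCone_smul hc hG) fun G hG h => ?_
  refine eq_zero_of_gramSum_eq_zero hint hG ?_
  have h' : gramCoeff g N G = 0 := h
  rw [← toPoly_gramCoeff hG, h']
  simp [toPoly]

/-- Were `f` outside the closed cone of coefficient vectors, a separating functional would define a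
sequence `z` with `L_z (f) < 0`. Testing it on rank-one Gram matrices puts `z` in the moment cone, a
contradiction. -/
theorem exists_gramSum_eq (hint : (interior (designSpace g)).Nonempty)
    {f : MvPolynomial (Fin n) ℝ} (hf : f.totalDegree ≤ 2 * N)
    (hpos : ∀ z ∈ momentCone g N, 0 ≤ riesz z f) : ∃ G ∈ gramCone g N, gramSum G = f := by
  classical
  set b : MultiIdx n (2 * N) → ℝ := fun α => coeff α.1 f with hb
  have hfb : toPoly b = f := toPoly_coeff hf
  by_cases hmem : b ∈ gramCoeff g N '' gramCone g N
  · obtain ⟨G, hG, hGb⟩ := hmem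
    exact ⟨G, hG, by rw [← toPoly_gramCoeff hG, hGb, hfb]⟩
  exfalso
  obtain ⟨φ, hφ, hφb⟩ := exists_separating_of_cone (isClosed_gramCoeff_image hint)
    (by
      rintro _ ⟨G, hG, rfl⟩ _ ⟨H, hH, rfl⟩ a c ha hc _
      exact ⟨a • G + c • H, gramCone_smul_add ha hc hG hH, by rw [map_add, map_smul, map_smul]⟩)
    ⟨0, zero_mem_gramCone, map_zero _⟩
    (by
      rintro c hc _ ⟨G, hG, rfl⟩
      exact ⟨c • G, gramCone_smul hc hG, map_smul _ _ _⟩) hmem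
  set z : MultiIdx n (2 * N) → ℝ := fun α => φ (Pi.single α 1) with hz
  have hφz : ∀ u, φ u = riesz z (toPoly u) := by
    intro u
    rw [LinearMap.pi_apply_eq_sum_univ φ u, riesz_toPoly]
    refine Finset.sum_congr rfl fun α _ => ?_
    rw [smul_eq_mul, hz]
    congr 3
    ext β
    simp [Pi.single_apply, eq_comm]
  have hgram : ∀ G ∈ gramCone g N, 0 ≤ riesz z (gramSum G) := by
    intro G hG
    rw [← toPoly_gramCoeff hG, ← hφz]
    exact hφ _ ⟨G, hG, rfl⟩
  have hone : ∀ (o : Option (Fin m)), halfDegree (describing g o) ≤ N →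
      ∀ h : MvPolynomial (Fin n) ℝ, h.totalDegree ≤ N - halfDegree (describing g o) →
      0 ≤ riesz z (describing g o * h ^ 2) := by
    intro o ho h hh
    -- The rank-one family used below lies in `gramCone` only for a nonzero describing polynomial.
    by_cases h0 : describing g o = 0
    · rw [h0, zero_mul, ← rieszHom_apply, map_zero]
    set u : MultiIdx n (N - halfDegree (describing g o)) → ℝ := fun α => coeff α.1 h
    have hu : toPoly u = h := toPoly_coeff hh
    have := hgram (Pi.single o (vecMulVec u u)) (by
      intro o'
      by_cases hoo : o' = o
      · subst hoo
        rw [Pi.single_eq_same]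
        refine ⟨?_, fun h => ?_⟩
        · have := posSemidef_vecMulVec_self_star u
          rwa [star_trivial] at this
        · rcases h with h | h
          · exact absurd h h0
          · omega
      · rw [Pi.single_eq_of_ne hoo]
        exact ⟨PosSemidef.zero, fun _ => rfl⟩)
    rw [gramSum, Finset.sum_eq_single o] at this
    · rwa [Pi.single_eq_same, gramPoly_vecMulVec, hu] at this
    · intro o' _ hoo
      rw [Pi.single_eq_of_ne hoo, gramPoly_zero, mul_zero]
    · simp
  have hzc : z ∈ momentCone g N := by
    refine ⟨fun h hh => ?_, fun j hj h hh => hone (some j) hj h hh⟩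
    have := hone none (by rw [halfDegree_describing_none]; omega) h
      (by rw [halfDegree_describing_none]; omega)
    simpa [describing] using this
  have := hpos z hzc
  rw [← hfb, ← hφz] at this
  exact absurd hφb (not_lt.2 this)

theorem mem_quadModule_of_riesz_nonneg (hint : (interior (designSpace g)).Nonempty)
    {f : MvPolynomial (Fin n) ℝ} (hf : f.totalDegree ≤ 2 * d)
    (hpos : ∀ y ∈ sdpCone g d δ, 0 ≤ riesz y f) : f ∈ quadModule g d δ := by
  obtain ⟨G, hG, hGf⟩ := exists_gramSum_eq (N := d + δ) hint (f := f) (by omega) (by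
    intro z hz
    have := hpos (fun α => z (α.lift (by omega))) (mem_sdpCone_iff.2 ⟨z, hz, fun _ => rfl⟩)
    rwa [riesz_lift (z := z) (show 2 * d ≤ 2 * (d + δ) by omega) (fun _ => rfl) hf] at this)
  refine ⟨hf, gramPoly (G none), ?_, fun j => gramPoly (G (some j)), fun j => ?_, fun j hj => ?_, ?_⟩
  · obtain ⟨k, h, hh, he⟩ := gramPoly_mem_sosCone (hG none).1
    exact ⟨k, h, fun i => (hh i).trans (Nat.sub_le _ _), he⟩
  · exact gramPoly_mem_sosCone (hG (some j)).1
  · change gramPoly (G (some j)) = 0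
    rw [(hG (some j)).2 (Or.inr hj), gramPoly_zero]
  · rw [← hGf, gramSum, Fintype.sum_option]
    simp [describing]

theorem riesz_nonneg_of_mem_quadModule {f : MvPolynomial (Fin n) ℝ} (hf : f ∈ quadModule g d δ)
    {y : MultiIdx n (2 * d) → ℝ} (hy : y ∈ sdpCone g d δ) : 0 ≤ riesz y f := by
  obtain ⟨hdeg, σ₀, ⟨k, h, hh, rfl⟩, σ, hσ, hσ0, hfσ⟩ := hf
  obtain ⟨z, hz, hyz⟩ := mem_sdpCone_iff.1 hy
  rw [riesz_lift (by omega) hyz hdeg, hfσ, riesz_add, riesz_sum, riesz_sum]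
  refine add_nonneg (Finset.sum_nonneg fun i _ => hz.1 _ (hh i)) (Finset.sum_nonneg fun j _ => ?_)
  by_cases hj : d + δ < halfDegree (g j)
  · rw [hσ0 j hj, mul_zero, ← rieszHom_apply, map_zero]
  · obtain ⟨k, h, hh, hs⟩ := hσ j
    rw [hs, Finset.mul_sum, riesz_sum]
    exact Finset.sum_nonneg fun i _ => hz.2 j (not_lt.1 hj) _ (hh i)

/-- Since `y_0` may vanish, `y` cannot be normalized directly; `y + ε y₀` can, and `ε` is arbitrary.
-/
theorem riesz_nonneg_sdpCone_of_feasibleSet {f : MvPolynomial (Fin n) ℝ}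
    (hpos : ∀ y ∈ feasibleSet g d δ, 0 ≤ riesz y f) {y₀ : MultiIdx n (2 * d) → ℝ}
    (hy₀ : y₀ ∈ feasibleSet g d δ) {y : MultiIdx n (2 * d) → ℝ} (hy : y ∈ sdpCone g d δ) :
    0 ≤ riesz y f := by
  obtain ⟨z, hz, hyz⟩ := mem_sdpCone_iff.1 hy
  obtain ⟨z₀, hz₀, hyz₀⟩ := mem_sdpCone_iff.1 hy₀.1
  have hnn : 0 ≤ y ⟨0, by simp⟩ := by
    have := hz.1 1 (by simp)
    rw [one_pow, ← C_1, riesz_C, one_mul] at this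
    rw [hyz]; exact this
  have key : ∀ ε > 0, 0 ≤ riesz y f + ε * riesz y₀ f := by
    intro ε hε
    have hc : 0 < y ⟨0, by simp⟩ + ε := by linarith
    set c := (y ⟨0, by simp⟩ + ε)⁻¹ with hcdef
    have hcpos : 0 < c := inv_pos.2 hc
    have hmem : c • y + (c * ε) • y₀ ∈ feasibleSet g d δ := by
      refine ⟨mem_sdpCone_iff.2 ⟨c • z + (c * ε) • z₀, ⟨fun h hh => ?_, fun j hj h hh => ?_⟩,
        fun α => by simp [hyz, hyz₀]⟩, ?_⟩
      · rw [riesz_smul_add]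
        exact add_nonneg (mul_nonneg hcpos.le (hz.1 h hh))
          (mul_nonneg (by positivity) (hz₀.1 h hh))
      · rw [riesz_smul_add]
        exact add_nonneg (mul_nonneg hcpos.le (hz.2 j hj h hh))
          (mul_nonneg (by positivity) (hz₀.2 j hj h hh))
      · have h1 := hy₀.2
        rw [Pi.add_apply, Pi.smul_apply, Pi.smul_apply, h1, smul_eq_mul, smul_eq_mul, mul_one,
          ← mul_add, hcdef, inv_mul_cancel₀ hc.ne']
    have := hpos _ hmem
    rw [riesz_smul_add, mul_assoc, ← mul_add] at this
    exact nonneg_of_mul_nonneg_right this hcpos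
  by_contra! hneg
  have h0 := hpos y₀ hy₀
  -- This `ε` keeps `ε L_{y₀} (f)` at most half of `-L_y (f)`; the added `1` avoids a zero
  -- denominator.
  have := key (-riesz y f / (2 * (riesz y₀ f + 1))) (by
    apply div_pos <;> linarith)
  have h2 : -riesz y f / (2 * (riesz y₀ f + 1)) * riesz y₀ f ≤ -riesz y f / 2 := by
    rw [div_mul_eq_mul_div, div_le_div_iff₀ (by linarith) two_pos]
    nlinarith
  linarith

end Duality

/-! ### Optimality conditions and uniqueness -/

section Main

variable {n m d δ p : ℕ} {q : ℝ} {g : Fin m → MvPolynomial (Fin n) ℝ}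
  {A : Matrix (Fin p) (MultiIdx n d) ℝ} {y : MultiIdx n (2 * d) → ℝ}

theorem convex_image_infoMatrix : Convex ℝ (infoMatrix A '' feasibleSet g d δ) := by
  rintro _ ⟨y, hy, rfl⟩ _ ⟨z, hz, rfl⟩ a b ha hb hab
  exact ⟨a • y + b • z, convex_feasibleSet hy hz ha hb hab, infoMatrix_smul_add a b y z⟩

theorem posSemidef_of_mem_image :
    ∀ M ∈ infoMatrix A '' feasibleSet g d δ, M.PosSemidef := by
  rintro _ ⟨y, hy, rfl⟩
  exact posSemidef_infoMatrix hy.1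

theorem exists_isOptimalSDP
    (hball : ∃ (j : Fin m) (R : ℝ), g j = C (R ^ 2) - ∑ i : Fin n, X i ^ 2)
    (hint : (interior (designSpace g)).Nonempty) (hA : A.rank = p) :
    ∃ y, IsOptimalSDP g δ q A y := by
  obtain ⟨y₀, hy₀, hpd⟩ := exists_mem_feasibleSet_posDef (δ := δ) hint hA
  -- For `p = 0` there is only one matrix, so every feasible point is optimal.
  rcases Nat.eq_zero_or_pos p with rfl | hp
  · exact ⟨y₀, hy₀, fun z _ => by rw [Subsingleton.elim (infoMatrix A z) (infoMatrix A y₀)]⟩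
  · obtain ⟨_, ⟨y, hy, rfl⟩, hmax⟩ := exists_kiefer_max (q := q) hp
      ((isCompact_feasibleSet hball).image (continuous_infoMatrix A)) posSemidef_of_mem_image
      ⟨y₀, hy₀, rfl⟩ hpd
    exact ⟨y, hy, fun z hz => hmax _ ⟨z, hz, rfl⟩⟩

theorem isOptimalSDP_iff_trace_le (hq : q < 1) (hint : (interior (designSpace g)).Nonempty)
    (hA : A.rank = p) : IsOptimalSDP g δ q A y ↔
      y ∈ feasibleSet g d δ ∧ (infoMatrix A y).PosDef ∧ ∀ z ∈ feasibleSet g d δ,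
        (matPow (infoMatrix A y) (q - 1) * infoMatrix A z).trace ≤
          (matPow (infoMatrix A y) q).trace := by
  obtain ⟨y₀, hy₀, hpd⟩ := exists_mem_feasibleSet_posDef (δ := δ) hint hA
  rcases Nat.eq_zero_or_pos p with rfl | hp
  · refine ⟨fun h => ⟨h.1, ?_, fun z _ => by simp [trace]⟩, fun h => ⟨h.1, fun z _ => ?_⟩⟩
    · rwa [Subsingleton.elim (infoMatrix A y) (infoMatrix A y₀)]
    · rw [Subsingleton.elim (infoMatrix A z) (infoMatrix A y)]
  · constructor
    · rintro ⟨hy, hmax⟩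
      have hmax' : ∀ N ∈ infoMatrix A '' feasibleSet g d δ,
          kiefer q N ≤ kiefer q (infoMatrix A y) := by
        rintro _ ⟨z, hz, rfl⟩
        exact hmax z hz
      have hM := posDef_of_kiefer_max hp hq convex_image_infoMatrix posSemidef_of_mem_image
        ⟨y₀, hy₀, rfl⟩ hpd ⟨y, hy, rfl⟩ hmax'
      exact ⟨hy, hM, fun z hz => trace_le_of_kiefer_max hp hq convex_image_infoMatrix
        posSemidef_of_mem_image ⟨y, hy, rfl⟩ hM hmax' ⟨z, hz, rfl⟩⟩
    · rintro ⟨hy, hM, h⟩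
      exact ⟨hy, fun z hz => kiefer_le_of_trace_le hp hq hM (posSemidef_infoMatrix hz.1) (h z hz)⟩

theorem isOptimalSDP_iff_riesz_nonneg (hq : q < 1) (hint : (interior (designSpace g)).Nonempty)
    (hA : A.rank = p) : IsOptimalSDP g δ q A y ↔
      y ∈ feasibleSet g d δ ∧ (infoMatrix A y).PosDef ∧ ∀ z ∈ feasibleSet g d δ,
        0 ≤ riesz z (dualPoly q A y) := by
  rw [isOptimalSDP_iff_trace_le hq hint hA]
  refine and_congr_right fun _ => and_congr_right fun _ => forall₂_congr fun z hz => ?_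
  rw [riesz_dualPoly y hz.2, sub_nonneg]

/-- The Dirac measure at `x` is feasible, and its functional is evaluation at `x`. -/
theorem IsOptimalSDP.eval_dualPoly_nonneg (hq : q < 1)
    (hint : (interior (designSpace g)).Nonempty) (hA : A.rank = p) (h : IsOptimalSDP g δ q A y)
    {x : Fin n → ℝ} (hx : x ∈ designSpace g) : 0 ≤ eval x (dualPoly q A y) := by
  have := ((isOptimalSDP_iff_riesz_nonneg hq hint hA).1 h).2.2 _
    (averageMoments_mem_feasibleSet (S := {x}) (Finset.singleton_nonempty x) (by simpa using hx))
  rw [riesz_averageMoments _ (totalDegree_dualPoly_le y)] at this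
  simpa using this

theorem isOptimalSDP_iff_mem_quadModule (hq : q < 1)
    (hint : (interior (designSpace g)).Nonempty) (hA : A.rank = p) :
    IsOptimalSDP g δ q A y ↔ y ∈ feasibleSet g d δ ∧ (infoMatrix A y).PosDef ∧
      dualPoly q A y ∈ quadModule g d δ := by
  rw [isOptimalSDP_iff_riesz_nonneg hq hint hA]
  refine and_congr_right fun hy => and_congr_right fun _ => ⟨fun h => ?_, fun h z hz => ?_⟩
  · exact mem_quadModule_of_riesz_nonneg hint (totalDegree_dualPoly_le y) fun z hz =>
      riesz_nonneg_sdpCone_of_feasibleSet h hy hz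
  · exact riesz_nonneg_of_mem_quadModule h hz.1

theorem momentMatrix_injective :
    Function.Injective (momentMatrix : (MultiIdx n (2 * d) → ℝ) → _) := by
  intro y z h
  ext γ
  obtain ⟨α, β, hα, hβ, hαβ⟩ := exists_add_of_degree_le γ.1 γ.2
  have := congrFun (congrFun h ⟨α, hα⟩) ⟨β, hβ⟩
  simp only [momentMatrix] at this
  have hγ : (⟨α + β, by rw [hαβ]; exact γ.2⟩ : MultiIdx n (2 * d)) = γ := Subtype.ext hαβ
  rwa [hγ] at this

/-- Full column rank makes `A` left-cancellable; cancelling once, transposing and cancelling again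
recovers the moment matrix. -/
theorem infoMatrix_injective (hA : A.rank = Fintype.card (MultiIdx n d)) :
    Function.Injective (infoMatrix A) := by
  have hli : LinearIndependent ℝ A.col := by
    rw [linearIndependent_iff_card_eq_finrank_span, Set.finrank, ← rank_eq_finrank_span_cols, hA]
  have hinj : Function.Injective A.mulVec := mulVec_injective_iff.2 hli
  have hcancel : ∀ {κ : Type} (M N : Matrix (MultiIdx n d) κ ℝ), A * M = A * N → M = N := by
    intro κ M N h
    ext α j
    exact congrFun (hinj (a₁ := M.col j) (a₂ := N.col j) (by
      ext i; exact congrFun (congrFun h i) j)) α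
  intro y z h
  refine momentMatrix_injective ?_
  simp only [infoMatrix, Matrix.mul_assoc] at h
  have h1 := congrArg transpose (hcancel _ _ h)
  rw [transpose_mul, transpose_mul, transpose_transpose] at h1
  exact transpose_injective (hcancel _ _ h1)

theorem existsUnique_isOptimalSDP (hq : q < 1)
    (hball : ∃ (j : Fin m) (R : ℝ), g j = C (R ^ 2) - ∑ i : Fin n, X i ^ 2)
    (hint : (interior (designSpace g)).Nonempty) (hA : A.rank = p)
    (hA' : A.rank = Fintype.card (MultiIdx n d)) : ∃! y, IsOptimalSDP g δ q A y := by
  have hp : 0 < p := by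
    have : Nonempty (MultiIdx n d) := ⟨⟨0, by simp⟩⟩
    rw [← hA, hA']
    exact Fintype.card_pos
  obtain ⟨y, hy⟩ := exists_isOptimalSDP (q := q) (δ := δ) hball hint hA
  refine ⟨y, hy, fun z hz => (infoMatrix_injective hA' ?_).symm⟩
  have h1 := (isOptimalSDP_iff_trace_le hq hint hA).1 hy
  have h2 := (isOptimalSDP_iff_trace_le hq hint hA).1 hz
  exact eq_of_kiefer_eq hp hq h1.2.1 h2.2.1 (h1.2.2 z hz.1) (hz.2 y hy.1)

end Main

end OptDesign

theorem mainTheorem5 {n m p : ℕ} (d δ : ℕ) (q : ℝ) (hq : q < 1)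
    (g : Fin m → MvPolynomial (Fin n) ℝ)
    (hball : ∃ (j : Fin m) (R : ℝ), g j = C (R ^ 2) - ∑ i : Fin n, X i ^ 2)
    (hint : (interior (OptDesign.designSpace g)).Nonempty)
    (A : Matrix (Fin p) (OptDesign.MultiIdx n d) ℝ) (hA : A.rank = p) :
    (∃ y, OptDesign.IsOptimalSDP g δ q A y) ∧
    (∀ y, OptDesign.IsOptimalSDP g δ q A y →
      (OptDesign.infoMatrix A y).PosDef ∧
      (∀ x ∈ OptDesign.designSpace g, 0 ≤ eval x (OptDesign.dualPoly q A y)) ∧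
      OptDesign.riesz y (OptDesign.dualPoly q A y) = 0) ∧
    (∀ y : OptDesign.MultiIdx n (2 * d) → ℝ,
      OptDesign.IsOptimalSDP g δ q A y ↔
        y ∈ OptDesign.feasibleSet g d δ ∧
        (OptDesign.infoMatrix A y).PosDef ∧
        OptDesign.dualPoly q A y ∈ OptDesign.quadModule g d δ) ∧
    (A.rank = Fintype.card (OptDesign.MultiIdx n d) →
      ∃! y, OptDesign.IsOptimalSDP g δ q A y) := by
  refine ⟨OptDesign.exists_isOptimalSDP hball hint hA, fun y hy => ⟨?_, fun x hx => ?_, ?_⟩,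
    fun y => OptDesign.isOptimalSDP_iff_mem_quadModule hq hint hA,
    OptDesign.existsUnique_isOptimalSDP hq hball hint hA⟩
  · exact ((OptDesign.isOptimalSDP_iff_trace_le hq hint hA).1 hy).2.1
  · exact hy.eval_dualPoly_nonneg hq hint hA hx
  -- At `z = y` the two traces coincide because `M ^ (q - 1) M = M ^ q`.
  · rw [OptDesign.riesz_dualPoly y hy.1.2, OptDesign.matPow_sub_one_mul_self
      ((OptDesign.isOptimalSDP_iff_trace_le hq hint hA).1 hy).2.1, sub_self]
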